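/- **Setting.** Let $e=(1,\dots,1)^T\in\mathbb R^n$. A Markovian binary tree (MBT) is given by $a\in\mathbb R^n$ and a bilinear map $b(u,v)=B(u\otimes v)$ on $\mathbb R^n$, with $a\ge 0$, $B\ge 0$ entrywise, and $e=a+b(e,e)$. Let $x^\ast$ be the minimal nonnegative solution of $x=a+b(x,x)$, and put $y^\ast=e-x^\ast$, $R=b(e,\cdot)+b(\cdot,e)$ and $H_y=b(\cdot,e)+b(e,\cdot)-b(y,\cdot)$. The MBT is supercritical if $\rho(R)>1$ and critical if $\rho(R)=1$, where $\rho$ is the spectral radius. A (right) Perron vector of a nonnegative matrix $M$ is an entrywise positive $u$ with $Mu=\rho(M)u$; a left Perron vector of $M$ is a Perron vector of $M^T$. Fix an entrywise positive vector $w\in\mathbb R^n$. The Perron iteration is $y_{k+1}=F(y_k)$, where $F(y)=\alpha u$, $u$ is a Perron vector of $H_y$ and $\alpha=-\dfrac{w^T(u-b(u,e)-b(e,u))}{w^Tb(u,u)}$. Let $$JF_{y^\ast}=\Bigl(I-\frac{y^\ast\sigma^T}{w^Tb(y^\ast,y^\ast)}\Bigr)A^\dagger\Bigl(I-\frac{y^\ast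 v^T}{v^Ty^\ast}\Bigr)b(\cdot,y^\ast),$$ where $\sigma^T=w^T(I-b(e-y^\ast,\cdot)-b(\cdot,e-y^\ast))$, $A=b(e-y^\ast,\cdot)+b(\cdot,e)-I$, $A^\dagger$ is the Moore–Penrose pseudoinverse of $A$, and $v$ is a left Perron vector of $H_{y^\ast}$. **Theorem.** Let $(a_t,b_t)$, $t\in[0,1]$, be a family of MBTs of size $n$ such that the coefficients of $b_t$ are analytic functions of $t$ on $[0,1]$. Suppose that it is supercritical for every $t\in[0,1)$ and critical for $t=1$, and that $R_t=b_t(e,\cdot)+b_t(\cdot,e)$ is irreducible for every $t\in[0,1]$. Denote by a subscript $t$ the quantities above for the MBT $(a_t,b_t)$, with $w$ fixed. Let $\widehat y_1$ and $\widehat v_1$ be a right and a left Perron vector of $R_1$. 1. For every $t\in[0,1)$ with $x_t^\ast>0$ entrywise, the map $F_t$ is Fréchet differentiable at $y_t^\ast$, and its Jacobian matrix there is $JF_{y_t^\ast,t}$. 2. $$\lim_{t\to1^-}\rho\bigl(JF_{y_t^\ast,t}\bigr)=\left|1-\frac{\widehat v_1^T b_1(\widehat y_1,\widehat y_1)}{w^Tb_1(\widehat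 y_1,\widehat y_1)}\,\frac{w^T\widehat y_1}{\widehat v_1^T\widehat y_1}\right|.$$ 3. In particular, if $w$ is a scalar multiple of $\widehat v_1$, this limit is $0$. -/

import Mathlib

open Filter Topology Set Matrix

namespace MBT

noncomputable section

/-- The bilinear operator `b(u,v) = B (u ⊗ v)`; the columns of `B` are indexed by pairs `(j,k)`. -/
def bil {n : ℕ} (B : Matrix (Fin n) (Fin n × Fin n) ℝ) (u v : Fin n → ℝ) : Fin n → ℝ :=
  B *ᵥ (fun p => u p.1 * v p.2)

/-- The matrix `b(u, ·)` of the linear map `v ↦ b(u,v)`. -/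
def bilL {n : ℕ} (B : Matrix (Fin n) (Fin n × Fin n) ℝ) (u : Fin n → ℝ) :
    Matrix (Fin n) (Fin n) ℝ :=
  Matrix.of fun i k => ∑ j, B i (j, k) * u j

/-- The matrix `b(·, v)` of the linear map `u ↦ b(u,v)`. -/
def bilR {n : ℕ} (B : Matrix (Fin n) (Fin n × Fin n) ℝ) (v : Fin n → ℝ) :
    Matrix (Fin n) (Fin n) ℝ :=
  Matrix.of fun i j => ∑ k, B i (j, k) * v k

theorem bilL_mulVec {n : ℕ} (B : Matrix (Fin n) (Fin n × Fin n) ℝ) (u v : Fin n → ℝ) :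
    bilL B u *ᵥ v = bil B u v := by
  ext i
  simp only [bilL, bil, Matrix.mulVec, dotProduct, Matrix.of_apply, Fintype.sum_prod_type,
    Finset.sum_mul]
  rw [Finset.sum_comm]
  simp only [mul_assoc]

theorem bilR_mulVec {n : ℕ} (B : Matrix (Fin n) (Fin n × Fin n) ℝ) (u v : Fin n → ℝ) :
    bilR B v *ᵥ u = bil B u v := by
  ext i
  simp only [bilR, bil, Matrix.mulVec, dotProduct, Matrix.of_apply, Fintype.sum_prod_type,
    Finset.sum_mul]
  refine Finset.sum_congr rfl fun j _ => Finset.sum_congr rfl fun k _ => ?_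
  ring

/-- The data of a Markovian binary tree: `a` and `B` are nonnegative, and the all-ones vector
`e = 1` solves `x = a + b(x,x)`. -/
structure IsMBT {n : ℕ} (a : Fin n → ℝ) (B : Matrix (Fin n) (Fin n × Fin n) ℝ) : Prop where
  a_nonneg : ∀ i, 0 ≤ a i
  B_nonneg : ∀ i p, 0 ≤ B i p
  one_eq : (1 : Fin n → ℝ) = a + bil B 1 1

/-- The nonnegative solutions of `x = a + b(x,x)`. -/
def solutions {n : ℕ} (a : Fin n → ℝ) (B : Matrix (Fin n) (Fin n × Fin n) ℝ) :
    Set (Fin n → ℝ) :=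
  {x | 0 ≤ x ∧ x = a + bil B x x}

open Classical in
/-- The extinction probability `x⋆`: the minimal (componentwise least) nonnegative solution of
`x = a + b(x,x)`. -/
def extinction {n : ℕ} (a : Fin n → ℝ) (B : Matrix (Fin n) (Fin n × Fin n) ℝ) : Fin n → ℝ :=
  if h : ∃ x, IsLeast (solutions a B) x then h.choose else 0

/-- The survival probability `y⋆ = e - x⋆`. -/
def survival {n : ℕ} (a : Fin n → ℝ) (B : Matrix (Fin n) (Fin n × Fin n) ℝ) : Fin n → ℝ :=
  1 - extinction a B

/-- The spectral radius of a real square matrix: the largest modulus of a complex eigenvalue. -/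
def specRad {n : ℕ} (M : Matrix (Fin n) (Fin n) ℝ) : ℝ :=
  (spectralRadius ℂ (M.map ((↑) : ℝ → ℂ))).toReal

/-- The matrix `R = B (e ⊗ I + I ⊗ e) = b(e,·) + b(·,e)`. -/
def matR {n : ℕ} (B : Matrix (Fin n) (Fin n × Fin n) ℝ) : Matrix (Fin n) (Fin n) ℝ :=
  bilL B 1 + bilR B 1

def IsSupercritical {n : ℕ} (B : Matrix (Fin n) (Fin n × Fin n) ℝ) : Prop :=
  1 < specRad (matR B)

def IsCritical {n : ℕ} (B : Matrix (Fin n) (Fin n × Fin n) ℝ) : Prop :=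
  specRad (matR B) = 1

/-- The matrix `H_y = b(·,e) + b(e,·) - b(y,·)`. -/
def matH {n : ℕ} (B : Matrix (Fin n) (Fin n × Fin n) ℝ) (y : Fin n → ℝ) :
    Matrix (Fin n) (Fin n) ℝ :=
  bilR B 1 + bilL B 1 - bilL B y

/-- `u` is a (right) Perron vector of `M`: a positive eigenvector for the eigenvalue `ρ(M)`.
A left Perron vector of `M` is a Perron vector of `Mᵀ`. -/
def IsPerronVector {n : ℕ} (M : Matrix (Fin n) (Fin n) ℝ) (u : Fin n → ℝ) : Prop :=
  (∀ i, 0 < u i) ∧ M *ᵥ u = specRad M • u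

open Classical in
/-- The Perron vector with entries summing to one, where it exists. -/
def perronVector {n : ℕ} (M : Matrix (Fin n) (Fin n) ℝ) : Fin n → ℝ :=
  if h : ∃ u, IsPerronVector M u ∧ ∑ i, u i = 1 then h.choose else 0

/-- The map `F` of the Perron iteration `y_{k+1} = F(y_k)`: the multiple `α u` of a Perron vector
`u` of `H_y`, where `α = - wᵀ(u - b(u,e) - b(e,u)) / wᵀ b(u,u)` is the nonzero solution of the
normalization equation `wᵀ(α u - b(α u,e) - b(e,α u) + b(α u,α u)) = 0`. The vector `α u` does not
depend on the scaling of `u`. -/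
def perronMap {n : ℕ} (B : Matrix (Fin n) (Fin n × Fin n) ℝ) (w y : Fin n → ℝ) : Fin n → ℝ :=
  let u := perronVector (matH B y)
  (-(w ⬝ᵥ (u - bil B u 1 - bil B 1 u)) / (w ⬝ᵥ bil B u u)) • u

/-- The Penrose equations: `X` is the Moore-Penrose pseudoinverse of `A`. -/
structure IsMoorePenrose {n : ℕ} (A X : Matrix (Fin n) (Fin n) ℝ) : Prop where
  mul_mul_left : A * X * A = A
  mul_mul_right : X * A * X = X
  symm_left : (A * X)ᵀ = A * X
  symm_right : (X * A)ᵀ = X * A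

open Classical in
/-- The Moore-Penrose pseudoinverse of a real square matrix. -/
def pinv {n : ℕ} (A : Matrix (Fin n) (Fin n) ℝ) : Matrix (Fin n) (Fin n) ℝ :=
  if h : ∃ X, IsMoorePenrose A X then h.choose else 0

/-- The Jacobian of the Perron iteration at a solution `y` of `y = H_y y`:
`(I - y σᵀ / wᵀb(y,y)) A† (I - y vᵀ / vᵀy) b(·,y)`, where
`σᵀ = wᵀ(I - b(e-y,·) - b(·,e-y))`, `A = b(e-y,·) + b(·,e) - I` and `v` is a left Perron vector
of `H_y`. -/
def jacobian {n : ℕ} (B : Matrix (Fin n) (Fin n × Fin n) ℝ) (w y : Fin n → ℝ) :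
    Matrix (Fin n) (Fin n) ℝ :=
  let σ : Fin n → ℝ := w ᵥ* (1 - bilL B (1 - y) - bilR B (1 - y))
  let A : Matrix (Fin n) (Fin n) ℝ := bilL B (1 - y) + bilR B 1 - 1
  let v : Fin n → ℝ := perronVector (matH B y)ᵀ
  (1 - (w ⬝ᵥ bil B y y)⁻¹ • vecMulVec y σ) * pinv A * (1 - (v ⬝ᵥ y)⁻¹ • vecMulVec y v) * bilR B y

end

end MBT

namespace MBT

/-! Differentiability: `z = F(y)`, with an eigenvalue `r`, solves `H_y z = r z` and `wᵀ(z - Rz +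
b(z,z)) = 0`. At `y = z = y⋆`, `r = 1`, the derivative in `(z,r)` is injective: pairing with the
left Perron vector `v` kills `r`, the kernel of `A = H_{y⋆} - I` is the line of `y⋆`, and `σᵀy⋆ =
wᵀb(y⋆,y⋆) > 0` removes that line. The implicit function theorem applies, and its derivative `J` is
pinned down by `σᵀJ = 0` and `AJ = Q b(·,y⋆)`, where `Q = I - y⋆vᵀ/vᵀy⋆`
(`IsSurvivalVector.hasFDerivAt_perronMap`).

Limit: a critical tree admits no nonzero survival vector, so `y_t⋆ → 0` by compactness
(`tendsto_survival`). Write `y_t⋆ = s z` with `s` the sum of the entries; then `z` and `v` converge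
to normalized Perron vectors of `R_1` and its transpose. The factor `I - y⋆σᵀ/wᵀb(y⋆,y⋆)` kills
`y⋆`, so `A†Q` may be replaced by `K = (A - z vᵀ)⁻¹Q`, which is continuous up to `t = 1`. As `σᵀ =
wᵀ(s b(·,z) - A)` and `AK = Q`, the apparent pole in `s` cancels, and `J` tends to the rank-one
matrix `z wᵀQ b(·,z) / wᵀb(z,z)`. Its possibly nonzero eigenvalue is `wᵀQ b(z,z) / wᵀb(z,z)`, and
`continuous_specRad` carries the limit over to spectral radii. -/

theorem tendsto_mulVec {m p ι R : Type*} [Fintype p] [NonUnitalNonAssocSemiring R]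
    [TopologicalSpace R] [IsTopologicalSemiring R] {l : Filter ι} {A : ι → Matrix m p R}
    {x : ι → p → R} {A₀ : Matrix m p R} {x₀ : p → R} (hA : Tendsto A l (𝓝 A₀))
    (hx : Tendsto x l (𝓝 x₀)) : Tendsto (fun i => A i *ᵥ x i) l (𝓝 (A₀ *ᵥ x₀)) := by
  have h : Continuous fun q : Matrix m p R × (p → R) => q.1 *ᵥ q.2 :=
    continuous_fst.matrix_mulVec continuous_snd
  exact (h.tendsto (A₀, x₀)).comp (hA.prodMk_nhds hx)

/-! ### Continuity of the spectral radius; rank-one matrices. -/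

section SpectralRadius

variable {n : ℕ}

theorem mem_spectrum_iff_exists_mulVec (M : Matrix (Fin n) (Fin n) ℂ) (μ : ℂ) :
    μ ∈ spectrum ℂ M ↔ ∃ x : Fin n → ℂ, x ≠ 0 ∧ M *ᵥ x = μ • x := by
  rw [spectrum.mem_iff, Matrix.isUnit_iff_isUnit_det, isUnit_iff_ne_zero, not_not,
    ← Matrix.exists_mulVec_eq_zero_iff]
  refine exists_congr fun x => and_congr_right fun _ => ?_
  rw [Matrix.sub_mulVec, Algebra.algebraMap_eq_smul_one, Matrix.smul_mulVec, Matrix.one_mulVec,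
    sub_eq_zero, eq_comm]

theorem exists_eigenvalue_norm_eq_specRad [NeZero n] (M : Matrix (Fin n) (Fin n) ℝ) :
    ∃ μ : ℂ, μ ∈ spectrum ℂ (M.map ((↑) : ℝ → ℂ)) ∧ ‖μ‖ = specRad M := by
  let _ : NormedRing (Matrix (Fin n) (Fin n) ℂ) := Matrix.linftyOpNormedRing
  let _ : NormedAlgebra ℂ (Matrix (Fin n) (Fin n) ℂ) := Matrix.linftyOpNormedAlgebra
  have : CompleteSpace (Matrix (Fin n) (Fin n) ℂ) := FiniteDimensional.complete ℂ _
  obtain ⟨μ, hμ, h⟩ := spectrum.exists_nnnorm_eq_spectralRadius (M.map ((↑) : ℝ → ℂ))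
  refine ⟨μ, hμ, ?_⟩
  rw [specRad, ← h]
  simp

theorem norm_le_specRad [NeZero n] {M : Matrix (Fin n) (Fin n) ℝ} {μ : ℂ}
    (hμ : μ ∈ spectrum ℂ (M.map ((↑) : ℝ → ℂ))) : ‖μ‖ ≤ specRad M := by
  let _ : NormedRing (Matrix (Fin n) (Fin n) ℂ) := Matrix.linftyOpNormedRing
  let _ : NormedAlgebra ℂ (Matrix (Fin n) (Fin n) ℂ) := Matrix.linftyOpNormedAlgebra
  have : CompleteSpace (Matrix (Fin n) (Fin n) ℂ) := FiniteDimensional.complete ℂ _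
  have h1 : (‖μ‖₊ : ENNReal) ≤ spectralRadius ℂ (M.map ((↑) : ℝ → ℂ)) :=
    le_iSup₂ (f := fun (k : ℂ) (_ : k ∈ spectrum ℂ (M.map ((↑) : ℝ → ℂ))) => (‖k‖₊ : ENNReal)) μ hμ
  obtain ⟨κ, -, h⟩ := spectrum.exists_nnnorm_eq_spectralRadius (M.map ((↑) : ℝ → ℂ))
  rw [specRad]
  rw [← h] at h1 ⊢
  simpa [← NNReal.coe_le_coe] using h1

theorem specRad_eq_of_forall [NeZero n] {M : Matrix (Fin n) (Fin n) ℝ} {r : ℝ}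
    (hle : ∀ μ ∈ spectrum ℂ (M.map ((↑) : ℝ → ℂ)), ‖μ‖ ≤ r)
    (hex : ∃ μ ∈ spectrum ℂ (M.map ((↑) : ℝ → ℂ)), ‖μ‖ = r) : specRad M = r := by
  obtain ⟨κ, hκ, h⟩ := exists_eigenvalue_norm_eq_specRad M
  obtain ⟨μ, hμ, h'⟩ := hex
  exact le_antisymm (h ▸ hle κ hκ) (h' ▸ norm_le_specRad hμ)

/-- Each of the `n` complex roots has modulus at most `specRad M`, hence distance at least `δ` from
`κ`. This prevents the spectral radius from dropping in a limit. -/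
theorem pow_le_norm_eval_charpoly [NeZero n] (M : Matrix (Fin n) (Fin n) ℝ) {κ : ℂ} {δ : ℝ}
    (hδ : 0 ≤ δ) (h : specRad M + δ ≤ ‖κ‖) :
    δ ^ n ≤ ‖(M.map ((↑) : ℝ → ℂ)).charpoly.eval κ‖ := by
  set N := M.map ((↑) : ℝ → ℂ)
  have hs := IsAlgClosed.splits N.charpoly
  have hcard : N.charpoly.roots.card = n := by
    rw [Polynomial.splits_iff_card_roots.1 hs, Matrix.charpoly_natDegree_eq_dim, Fintype.card_fin]
  have hroot : ∀ r ∈ N.charpoly.roots, δ ≤ ‖κ - r‖ := fun r hr => by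
    have h1 := norm_le_specRad (M := M)
      (Matrix.mem_spectrum_of_isRoot_charpoly (Polynomial.isRoot_of_mem_roots hr))
    have h2 := norm_sub_norm_le κ r
    linarith
  rw [hs.eval_eq_prod_roots_of_monic (Matrix.charpoly_monic N)]
  have key : ∀ s : Multiset ℂ, (∀ r ∈ s, δ ≤ ‖κ - r‖) → δ ^ s.card ≤ ‖(s.map (κ - ·)).prod‖ := by
    intro s
    induction s using Multiset.induction with
    | empty => simp
    | cons a s ih =>
      intro hs
      rw [Multiset.card_cons, pow_succ', Multiset.map_cons, Multiset.prod_cons, norm_mul]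
      exact mul_le_mul (hs a (Multiset.mem_cons_self a s))
        (ih fun r hr => hs r (Multiset.mem_cons_of_mem hr)) (by positivity) (norm_nonneg _)
  simpa [hcard] using key _ hroot

theorem continuous_map_ofReal :
    Continuous fun M : Matrix (Fin n) (Fin n) ℝ => M.map ((↑) : ℝ → ℂ) :=
  continuous_id.matrix_map Complex.continuous_ofReal

theorem exists_unit_eigenvector {N : Matrix (Fin n) (Fin n) ℂ} {μ : ℂ} (h : μ ∈ spectrum ℂ N) :
    ∃ x : Fin n → ℂ, ‖x‖ = 1 ∧ N *ᵥ x = μ • x := by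
  obtain ⟨x, hx, h⟩ := (mem_spectrum_iff_exists_mulVec N μ).1 h
  refine ⟨((‖x‖ : ℂ)⁻¹) • x, ?_, ?_⟩
  · rw [norm_smul, norm_inv, Complex.norm_real, norm_norm, inv_mul_cancel₀ (norm_ne_zero_iff.2 hx)]
  · rw [Matrix.mulVec_smul, h, smul_comm]

/-- Compactness of the unit sphere gives a limit eigenvector, so dominant eigenvalues converge to
some eigenvalue `μ₀` of the limit. A larger eigenvalue `κ` of the limit is impossible: nearby
characteristic polynomials stay at least `δ ^ n` in modulus at `κ`, yet they tend to zero there. -/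
theorem continuous_specRad : Continuous (specRad : Matrix (Fin n) (Fin n) ℝ → ℝ) := by
  rcases eq_or_ne n 0 with rfl | hn
  · exact continuous_of_const fun x y => congrArg _ (Subsingleton.elim x y)
  have : NeZero n := ⟨hn⟩
  rw [continuous_iff_ultrafilter]
  intro M₀ g hg
  choose μ hμ hμr using fun M : Matrix (Fin n) (Fin n) ℝ => exists_eigenvalue_norm_eq_specRad M
  choose x hx hxμ using fun M => exists_unit_eigenvector (hμ M)
  obtain ⟨x₀, hx₀, hlim⟩ := (isCompact_sphere (0 : Fin n → ℂ) 1).ultrafilter_le_nhds' (g.map x)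
    (Ultrafilter.mem_map.2 (Filter.univ_mem' fun M => by simpa using hx M))
  have hlim : Tendsto x g (𝓝 x₀) := hlim
  have hx₀' : x₀ ≠ 0 := by
    rintro rfl
    simp at hx₀
  have hN : Tendsto (fun M : Matrix (Fin n) (Fin n) ℝ => M.map ((↑) : ℝ → ℂ)) g
      (𝓝 (M₀.map ((↑) : ℝ → ℂ))) := (continuous_map_ofReal.tendsto M₀).mono_left hg
  have hNx : Tendsto (fun M => M.map ((↑) : ℝ → ℂ) *ᵥ x M) g
      (𝓝 (M₀.map ((↑) : ℝ → ℂ) *ᵥ x₀)) :=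
    tendsto_mulVec hN hlim
  obtain ⟨i, hi⟩ := Function.ne_iff.1 hx₀'
  have hi : x₀ i ≠ 0 := hi
  have hxi : Tendsto (fun M => x M i) g (𝓝 (x₀ i)) := (tendsto_pi_nhds.1 hlim) i
  -- The eigenvalue is read off as the quotient `(Mx)_i / x_i` at a coordinate where the limit
  -- eigenvector does not vanish.
  obtain ⟨μ₀, hμlim⟩ : ∃ μ₀, Tendsto μ g (𝓝 μ₀) := by
    refine ⟨_, (((tendsto_pi_nhds.1 hNx) i).div hxi hi).congr' ?_⟩
    filter_upwards [hxi.eventually_ne hi] with M hM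
    rw [Pi.div_apply, hxμ M]
    simp [hM]
  have heig : M₀.map ((↑) : ℝ → ℂ) *ᵥ x₀ = μ₀ • x₀ :=
    tendsto_nhds_unique hNx ((hμlim.smul hlim).congr fun M => (hxμ M).symm)
  have hρ : Tendsto specRad (g : Filter (Matrix (Fin n) (Fin n) ℝ)) (𝓝 ‖μ₀‖) :=
    hμlim.norm.congr hμr
  suffices h : ‖μ₀‖ = specRad M₀ from h ▸ hρ
  refine le_antisymm (norm_le_specRad ((mem_spectrum_iff_exists_mulVec _ _).2 ⟨x₀, hx₀', heig⟩)) ?_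
  obtain ⟨κ, hκ, hκr⟩ := exists_eigenvalue_norm_eq_specRad M₀
  by_contra! hlt
  rw [← hκr] at hlt
  set δ := (‖κ‖ - ‖μ₀‖) / 2 with hδ
  have hδ0 : 0 < δ := by linarith
  have hdet : Tendsto (fun M : Matrix (Fin n) (Fin n) ℝ =>
      ‖(M.map ((↑) : ℝ → ℂ)).charpoly.eval κ‖) g (𝓝 ‖(M₀.map ((↑) : ℝ → ℂ)).charpoly.eval κ‖) := by
    simp only [Matrix.eval_charpoly]
    exact ((continuous_norm.comp (continuous_const.sub continuous_id).matrix_det).tendsto _).comp hN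
  rw [(Matrix.mem_spectrum_iff_isRoot_charpoly.1 hκ).eq_zero, norm_zero] at hdet
  have : δ ^ n ≤ 0 := by
    refine ge_of_tendsto hdet ?_
    filter_upwards [hρ.eventually_lt_const (show ‖μ₀‖ < ‖κ‖ - δ by linarith)] with M hM
    exact pow_le_norm_eval_charpoly M hδ0.le (by linarith)
  exact absurd this (not_le.2 (pow_pos hδ0 n))

/-- The characteristic polynomial is `X^n - (u ⬝ᵥ v) X^(n-1)`. -/
theorem specRad_vecMulVec [NeZero n] (u v : Fin n → ℝ) :
    specRad (vecMulVec u v) = |u ⬝ᵥ v| := by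
  have hmap : (vecMulVec u v).map ((↑) : ℝ → ℂ) = vecMulVec (fun i => (u i : ℂ)) (fun i => (v i : ℂ)) := by
    ext i j
    simp [vecMulVec_apply]
  have hdot : (fun i => (u i : ℂ)) ⬝ᵥ (fun i => (v i : ℂ)) = ((u ⬝ᵥ v : ℝ) : ℂ) := by
    simp [dotProduct]
  have hroot : ∀ μ : ℂ, μ ∈ spectrum ℂ ((vecMulVec u v).map ((↑) : ℝ → ℂ)) ↔
      μ ^ n - ((u ⬝ᵥ v : ℝ) : ℂ) * μ ^ (n - 1) = 0 := fun μ => by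
    rw [Matrix.mem_spectrum_iff_isRoot_charpoly, hmap, Matrix.charpoly_vecMulVec, hdot,
      Polynomial.IsRoot.def]
    simp
  have hn : n = n - 1 + 1 := (Nat.succ_pred_eq_of_ne_zero (NeZero.ne n)).symm
  refine specRad_eq_of_forall (fun μ hμ => ?_) ⟨((u ⬝ᵥ v : ℝ) : ℂ), ?_, ?_⟩
  · have h := (hroot μ).1 hμ
    rw [show μ ^ n = μ * μ ^ (n - 1) by rw [← pow_succ', ← hn], ← sub_mul, mul_eq_zero] at h
    rcases h with h | h
    · rw [sub_eq_zero.1 h, Complex.norm_real, Real.norm_eq_abs]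
    · have hμ0 : μ = 0 := not_not.1 fun hne => pow_ne_zero _ hne h
      simp [hμ0]
  · rw [hroot, ← pow_succ', ← hn, sub_self]
  · rw [Complex.norm_real, Real.norm_eq_abs]

end SpectralRadius

/-! ### Perron–Frobenius theory for irreducible matrices. -/

section PerronFrobenius

variable {n : ℕ}

theorem mem_of_isIrreducible_of_closed {M : Matrix (Fin n) (Fin n) ℝ} (hM : M.IsIrreducible)
    {s : Set (Fin n)} (hs : s.Nonempty) (hclosed : ∀ i ∈ s, ∀ j, 0 < M i j → j ∈ s) (j : Fin n) :
    j ∈ s := by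
  let _ : Quiver (Fin n) := M.toQuiver
  obtain ⟨i, hi⟩ := hs
  obtain ⟨p, -⟩ := hM.connected i j
  induction p with
  | nil => exact hi
  | cons q e ih => exact hclosed _ ih _ e.down

theorem isIrreducible_of_pos_of_pos {M N : Matrix (Fin n) (Fin n) ℝ} (hM : M.IsIrreducible)
    (hN : ∀ i j, 0 ≤ N i j) (h : ∀ i j, 0 < M i j → 0 < N i j) : N.IsIrreducible := by
  rw [Matrix.isIrreducible_iff_exists_pow_pos hN]
  have hM' := (Matrix.isIrreducible_iff_exists_pow_pos hM.nonneg).1 hM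
  have key : ∀ k i j, 0 < (M ^ k) i j → 0 < (N ^ k) i j := by
    intro k
    induction k with
    | zero => intro i j h; simpa using h
    | succ k ih =>
      intro i j hij
      rw [pow_succ, Matrix.mul_apply] at hij ⊢
      have hNk := Matrix.pow_apply_nonneg hN k
      have hMk := Matrix.pow_apply_nonneg hM.nonneg k
      rw [Finset.sum_pos_iff_of_nonneg fun l _ => mul_nonneg (hMk i l) (hM.nonneg l j)] at hij
      obtain ⟨l, hl, hpos⟩ := hij
      refine (Finset.sum_pos_iff_of_nonneg fun l _ => mul_nonneg (hNk i l) (hN l j)).2 ⟨l, hl, ?_⟩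
      have h1 : 0 < (M ^ k) i l := lt_of_le_of_ne (hMk i l) fun h0 => by simp [← h0] at hpos
      have h2 : 0 < M l j := lt_of_le_of_ne (hM.nonneg l j) fun h0 => by simp [← h0] at hpos
      exact mul_pos (ih i l h1) (h l j h2)
  exact fun i j => (hM' i j).imp fun k hk => ⟨hk.1, key k i j hk.2⟩

/-- The zero set of `x` is closed under the edges of `M`: a vanishing sum of nonnegative terms
vanishes termwise. By connectivity a single zero would spread everywhere. -/
theorem pos_of_mulVec_eq_smul {M : Matrix (Fin n) (Fin n) ℝ} (hM : M.IsIrreducible)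
    {x : Fin n → ℝ} (hx : ∀ i, 0 ≤ x i) (hx0 : x ≠ 0) {r : ℝ} (h : M *ᵥ x = r • x) (i : Fin n) :
    0 < x i := by
  by_contra hi
  refine hx0 (funext fun j => ?_)
  refine mem_of_isIrreducible_of_closed hM (s := {i | x i = 0}) ⟨i, le_antisymm (not_lt.1 hi) (hx i)⟩ ?_ j
  intro i hi j hij
  have h1 := congrFun h i
  rw [Pi.smul_apply, show x i = 0 from hi, smul_zero, Matrix.mulVec, dotProduct,
    Finset.sum_eq_zero_iff_of_nonneg fun k _ => mul_nonneg (hM.nonneg i k) (hx k)] at h1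
  exact (mul_eq_zero.1 (h1 j (Finset.mem_univ j))).resolve_left hij.ne'

/-- Subtracting `c u` with `c = min x_i / u_i` leaves a nonnegative eigenvector with a zero entry,
which must vanish. -/
theorem exists_eq_smul_of_mulVec_eq_smul [NeZero n] {M : Matrix (Fin n) (Fin n) ℝ}
    (hM : M.IsIrreducible) {u x : Fin n → ℝ} {r : ℝ} (hu : ∀ i, 0 < u i) (hMu : M *ᵥ u = r • u)
    (hMx : M *ᵥ x = r • x) : ∃ c : ℝ, x = c • u := by
  obtain ⟨k, hk⟩ := Finite.exists_min fun i => x i / u i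
  refine ⟨x k / u k, ?_⟩
  by_contra hne
  have hpos := pos_of_mulVec_eq_smul hM (x := x - (x k / u k) • u) (fun i => ?_) (sub_ne_zero.2 hne)
    (r := r) (by rw [Matrix.mulVec_sub, Matrix.mulVec_smul, hMu, hMx, smul_sub, smul_comm]) k
  · simp [(hu k).ne'] at hpos
  · have := (le_div_iff₀ (hu i)).1 (hk i)
    simpa using this

theorem mulVec_le_mulVec {M : Matrix (Fin n) (Fin n) ℝ} (hM : ∀ i j, 0 ≤ M i j) {x y : Fin n → ℝ}
    (h : x ≤ y) : M *ᵥ x ≤ M *ᵥ y := fun i => by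
  simp only [Matrix.mulVec, dotProduct]
  exact Finset.sum_le_sum fun j _ => mul_le_mul_of_nonneg_left (h j) (hM i j)

theorem mulVec_nonneg {M : Matrix (Fin n) (Fin n) ℝ} (hM : ∀ i j, 0 ≤ M i j) {x : Fin n → ℝ}
    (h : 0 ≤ x) : 0 ≤ M *ᵥ x := by
  simpa using mulVec_le_mulVec hM h

theorem mulVec_map_ofReal (M : Matrix (Fin n) (Fin n) ℝ) (x : Fin n → ℝ) :
    M.map ((↑) : ℝ → ℂ) *ᵥ (fun i => (x i : ℂ)) = fun i => ((M *ᵥ x) i : ℂ) := by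
  ext i
  simp [Matrix.mulVec, dotProduct]

theorem norm_mul_norm_le_mulVec_norm {M : Matrix (Fin n) (Fin n) ℝ} (hM : ∀ i j, 0 ≤ M i j)
    {x : Fin n → ℂ} {μ : ℂ} (h : M.map ((↑) : ℝ → ℂ) *ᵥ x = μ • x) (i : Fin n) :
    ‖μ‖ * ‖x i‖ ≤ (M *ᵥ fun j => ‖x j‖) i := by
  have h1 := congrFun h i
  rw [← norm_mul, ← smul_eq_mul, ← Pi.smul_apply, ← h1, Matrix.mulVec, dotProduct, Matrix.mulVec,
    dotProduct]
  refine (norm_sum_le _ _).trans (Finset.sum_le_sum fun j _ => ?_)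
  simp [abs_of_nonneg (hM i j)]

/-- For an eigenvector `x`, compare `|x|` with `u` at an index maximizing `|x_i| / u_i`; this bounds
every eigenvalue by `r`. -/
theorem specRad_eq_of_pos_eigenvector [NeZero n] {M : Matrix (Fin n) (Fin n) ℝ}
    (hM : ∀ i j, 0 ≤ M i j) {u : Fin n → ℝ} {r : ℝ} (hu : ∀ i, 0 < u i) (h : M *ᵥ u = r • u) :
    specRad M = r := by
  have hr : 0 ≤ r := by
    have h1 : 0 ≤ r * u 0 := by
      rw [← smul_eq_mul, ← Pi.smul_apply, ← h]
      exact mulVec_nonneg hM (fun i => (hu i).le) 0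
    exact nonneg_of_mul_nonneg_left h1 (hu 0)
  refine specRad_eq_of_forall (fun μ hμ => ?_) ⟨(r : ℂ), ?_, by simp [abs_of_nonneg hr]⟩
  · obtain ⟨x, hx0, hx⟩ := (mem_spectrum_iff_exists_mulVec _ _).1 hμ
    obtain ⟨k, hk⟩ := Finite.exists_max fun i => ‖x i‖ / u i
    set c := ‖x k‖ / u k with hc
    have hle : ∀ j, ‖x j‖ ≤ c * u j := fun j => (div_le_iff₀ (hu j)).1 (hk j)
    have hck : c * u k = ‖x k‖ := div_mul_cancel₀ _ (hu k).ne'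
    have hcpos : 0 < c := by
      obtain ⟨j, hj⟩ := Function.ne_iff.1 hx0
      exact (div_pos (norm_pos_iff.2 hj) (hu j)).trans_le (hk j)
    have h1 : ‖μ‖ * (c * u k) ≤ r * (c * u k) := by
      rw [hck]
      refine (norm_mul_norm_le_mulVec_norm hM hx k).trans ?_
      calc (M *ᵥ fun j => ‖x j‖) k ≤ (M *ᵥ (c • u)) k :=
            mulVec_le_mulVec hM (fun j => hle j) k
        _ = r * ‖x k‖ := by
            rw [Matrix.mulVec_smul, h, ← hck]
            simp only [Pi.smul_apply, smul_eq_mul]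
            ring
    exact le_of_mul_le_mul_right h1 (mul_pos hcpos (hu k))
  · refine (mem_spectrum_iff_exists_mulVec _ _).2 ⟨fun i => (u i : ℂ), fun h0 => ?_, ?_⟩
    · exact (hu 0).ne' (by simpa using congrFun h0 0)
    · rw [mulVec_map_ofReal, h]
      ext i
      simp

theorem dotProduct_pos [NeZero n] {u v : Fin n → ℝ} (hu : ∀ i, 0 < u i) (hv : ∀ i, 0 < v i) :
    0 < u ⬝ᵥ v :=
  Finset.sum_pos (fun i _ => mul_pos (hu i) (hv i)) Finset.univ_nonempty

/-- A real left fixed vector `x` exists by the determinant. Then `|x| ≤ Mᵀ|x|`, and pairing with the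
positive `u` forces equality. -/
theorem exists_pos_left_eigenvector [NeZero n] {M : Matrix (Fin n) (Fin n) ℝ}
    (hM : M.IsIrreducible) {u : Fin n → ℝ} (hu : ∀ i, 0 < u i) (h : M *ᵥ u = u) :
    ∃ v : Fin n → ℝ, (∀ i, 0 < v i) ∧ Mᵀ *ᵥ v = v := by
  have hdet : (M - 1).det = 0 := Matrix.exists_mulVec_eq_zero_iff.1
    ⟨u, fun h0 => (hu 0).ne' (congrFun h0 0), by rw [Matrix.sub_mulVec, h, Matrix.one_mulVec, sub_self]⟩
  rw [← Matrix.det_transpose] at hdet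
  obtain ⟨x, hx0, hx⟩ := Matrix.exists_mulVec_eq_zero_iff.2 hdet
  rw [Matrix.transpose_sub, Matrix.transpose_one, Matrix.sub_mulVec, Matrix.one_mulVec,
    sub_eq_zero] at hx
  set v : Fin n → ℝ := fun i => |x i| with hv
  have hle : ∀ i, v i ≤ (Mᵀ *ᵥ v) i := fun i => by
    conv_lhs => rw [hv, ← hx]
    simp only [Matrix.mulVec, dotProduct]
    refine (Finset.abs_sum_le_sum_abs _ _).trans (Finset.sum_le_sum fun j _ => ?_)
    rw [abs_mul, abs_of_nonneg (hM.transpose.nonneg i j)]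
  have hsum : u ⬝ᵥ (Mᵀ *ᵥ v - v) = 0 := by
    rw [dotProduct_sub, Matrix.dotProduct_mulVec, Matrix.vecMul_transpose, h, sub_self]
  have hfix : Mᵀ *ᵥ v = v := by
    have h1 := (Finset.sum_eq_zero_iff_of_nonneg fun i _ =>
      mul_nonneg (hu i).le (sub_nonneg.2 (hle i))).1 hsum
    exact funext fun i => sub_eq_zero.1 ((mul_eq_zero.1 (h1 i (Finset.mem_univ i))).resolve_left (hu i).ne')
  refine ⟨v, pos_of_mulVec_eq_smul hM.transpose (fun i => abs_nonneg _) (fun h0 => hx0 ?_) (r := 1)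
    (by rw [hfix, one_smul]), hfix⟩
  exact funext fun i => abs_eq_zero.1 (congrFun h0 i)

theorem sum_pos_of_pos [NeZero n] {u : Fin n → ℝ} (hu : ∀ i, 0 < u i) : 0 < ∑ i, u i :=
  Finset.sum_pos (fun i _ => hu i) Finset.univ_nonempty

/-- The normalized Perron vector is obtained by rescaling any positive eigenvector. -/
theorem perronVector_eq [NeZero n] {M : Matrix (Fin n) (Fin n) ℝ} (hM : M.IsIrreducible)
    {u : Fin n → ℝ} {r : ℝ} (hu : ∀ i, 0 < u i) (h : M *ᵥ u = r • u) :
    perronVector M = (∑ i, u i)⁻¹ • u := by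
  have hs := sum_pos_of_pos hu
  have hr := specRad_eq_of_pos_eigenvector hM.nonneg hu h
  have hex : ∃ u, IsPerronVector M u ∧ ∑ i, u i = 1 := by
    refine ⟨(∑ i, u i)⁻¹ • u, ⟨fun i => mul_pos (inv_pos.2 hs) (hu i), ?_⟩, ?_⟩
    · rw [Matrix.mulVec_smul, h, hr, smul_comm]
    · simp only [Pi.smul_apply, smul_eq_mul, ← Finset.mul_sum, inv_mul_cancel₀ hs.ne']
  have hch := hex.choose_spec
  rw [perronVector, dif_pos hex]
  obtain ⟨c, hc⟩ := exists_eq_smul_of_mulVec_eq_smul hM hu h (hr ▸ hch.1.2)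
  have hsum := hch.2
  rw [hc]
  rw [hc] at hsum
  simp only [Pi.smul_apply, smul_eq_mul, ← Finset.mul_sum] at hsum
  rw [eq_inv_of_mul_eq_one_left hsum]

/-- Normalized nonnegative fixed vectors of matrices converging to an irreducible matrix converge
to its normalized positive fixed vector. -/
theorem tendsto_fixed_vector [NeZero n] {ι : Type*} {l : Filter ι} {M : ι → Matrix (Fin n) (Fin n) ℝ}
    {M₀ : Matrix (Fin n) (Fin n) ℝ} (hM₀ : M₀.IsIrreducible) (hM : Tendsto M l (𝓝 M₀))
    {u : Fin n → ℝ} (hu : ∀ i, 0 < u i) (hMu : M₀ *ᵥ u = u) {x : ι → Fin n → ℝ}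
    (hx : ∀ᶠ t in l, x t ∈ stdSimplex ℝ (Fin n) ∧ M t *ᵥ x t = x t) :
    Tendsto x l (𝓝 ((∑ i, u i)⁻¹ • u)) := by
  -- By compactness of the simplex every ultrafilter has a limit; being fixed by `M₀` with entries
  -- summing to one, it is always the same vector.
  rw [tendsto_iff_ultrafilter]
  intro g hg
  obtain ⟨y, hy, hlim⟩ := (isCompact_stdSimplex ℝ (Fin n)).ultrafilter_le_nhds' (g.map x)
    (Ultrafilter.mem_map.2 ((hx.filter_mono hg).mono fun t ht => ht.1))
  have hlim : Tendsto x g (𝓝 y) := hlim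
  have hfix : M₀ *ᵥ y = y := by
    refine tendsto_nhds_unique (tendsto_mulVec (hM.mono_left hg) hlim) (hlim.congr' ?_)
    filter_upwards [hx.filter_mono hg] with t ht using ht.2.symm
  obtain ⟨c, hc⟩ := exists_eq_smul_of_mulVec_eq_smul hM₀ hu (r := 1) (by rw [hMu, one_smul])
    (by rw [hfix, one_smul])
  have hsum := hy.2
  rw [hc] at hsum
  simp only [Pi.smul_apply, smul_eq_mul, ← Finset.mul_sum] at hsum
  rw [← eq_inv_of_mul_eq_one_left hsum, ← hc]
  exact hlim

end PerronFrobenius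

/-! ### Pseudoinverses of matrices with a one-dimensional kernel. -/

section RankOneKernel

variable {n : ℕ} {A : Matrix (Fin n) (Fin n) ℝ} {y v : Fin n → ℝ}

theorem vecMulVec_mulVec_eq_smul (u v x : Fin n → ℝ) : vecMulVec u v *ᵥ x = (v ⬝ᵥ x) • u := by
  ext i
  simp only [Matrix.mulVec, dotProduct, vecMulVec_apply, Pi.smul_apply, smul_eq_mul, Finset.sum_mul]
  exact Finset.sum_congr rfl fun j _ => by ring

theorem vecMul_vecMulVec_eq_smul (u v x : Fin n → ℝ) : x ᵥ* vecMulVec u v = (x ⬝ᵥ u) • v := by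
  ext i
  simp only [Matrix.vecMul, dotProduct, vecMulVec_apply, Pi.smul_apply, smul_eq_mul, Finset.sum_mul]
  exact Finset.sum_congr rfl fun j _ => by ring

/-- `A` has kernel spanned by `y`, and `v` spans the cokernel, with `vᵀ y ≠ 0`. -/
structure HasSimpleKernel (A : Matrix (Fin n) (Fin n) ℝ) (y v : Fin n → ℝ) : Prop where
  mulVec_eq : A *ᵥ y = 0
  vecMul_eq : v ᵥ* A = 0
  ker : ∀ x, A *ᵥ x = 0 → ∃ c : ℝ, x = c • y
  dot_ne : v ⬝ᵥ y ≠ 0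

/-- The projection along `y` onto the orthogonal complement of `v`. -/
noncomputable def proj (y v : Fin n → ℝ) : Matrix (Fin n) (Fin n) ℝ :=
  1 - (v ⬝ᵥ y)⁻¹ • vecMulVec y v

namespace HasSimpleKernel

theorem dot_self_left (h : HasSimpleKernel A y v) : y ⬝ᵥ y ≠ 0 := fun h0 => by
  have := h.dot_ne
  rw [dotProduct_self_eq_zero.1 h0, dotProduct_zero] at this
  exact this rfl

theorem dot_self_right (h : HasSimpleKernel A y v) : v ⬝ᵥ v ≠ 0 := fun h0 => by
  have := h.dot_ne
  rw [dotProduct_self_eq_zero.1 h0, zero_dotProduct] at this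
  exact this rfl

theorem isUnit_det_add (h : HasSimpleKernel A y v) : IsUnit (A + vecMulVec v y).det := by
  rw [isUnit_iff_ne_zero, Ne, ← Matrix.exists_mulVec_eq_zero_iff]
  rintro ⟨x, hx0, hx⟩
  rw [Matrix.add_mulVec, vecMulVec_mulVec_eq_smul] at hx
  have h1 : v ⬝ᵥ (A *ᵥ x + (y ⬝ᵥ x) • v) = 0 := by rw [hx, dotProduct_zero]
  rw [dotProduct_add, Matrix.dotProduct_mulVec, h.vecMul_eq, zero_dotProduct, zero_add,
    dotProduct_smul, smul_eq_mul, mul_eq_zero, or_iff_left h.dot_self_right] at h1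
  rw [h1, zero_smul, add_zero] at hx
  obtain ⟨c, rfl⟩ := h.ker x hx
  rw [dotProduct_smul, smul_eq_mul, mul_eq_zero, or_iff_left h.dot_self_left] at h1
  exact hx0 (by rw [h1, zero_smul])

theorem isUnit_det_sub (h : HasSimpleKernel A y v) : IsUnit (A - vecMulVec y v).det := by
  rw [isUnit_iff_ne_zero, Ne, ← Matrix.exists_mulVec_eq_zero_iff]
  rintro ⟨x, hx0, hx⟩
  rw [Matrix.sub_mulVec, vecMulVec_mulVec_eq_smul] at hx
  have h1 : v ⬝ᵥ (A *ᵥ x - (v ⬝ᵥ x) • y) = 0 := by rw [hx, dotProduct_zero]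
  rw [dotProduct_sub, Matrix.dotProduct_mulVec, h.vecMul_eq, zero_dotProduct, zero_sub,
    dotProduct_smul, smul_eq_mul, neg_eq_zero, mul_eq_zero, or_iff_left h.dot_ne] at h1
  rw [h1, zero_smul, sub_zero] at hx
  obtain ⟨c, rfl⟩ := h.ker x hx
  rw [dotProduct_smul, smul_eq_mul, mul_eq_zero, or_iff_left h.dot_ne] at h1
  exact hx0 (by rw [h1, zero_smul])

/-- Existence is what excludes the default value `0` of `pinv`. -/
theorem exists_isMoorePenrose (h : HasSimpleKernel A y v) : ∃ X, IsMoorePenrose A X := by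
  set M := A + vecMulVec v y with hM
  have hu := h.isUnit_det_add
  have hMM : M * M⁻¹ = 1 := Matrix.mul_nonsing_inv M hu
  have hMM' : M⁻¹ * M = 1 := Matrix.nonsing_inv_mul M hu
  have hy := h.dot_self_left
  have hv := h.dot_self_right
  have hMy : M *ᵥ y = (y ⬝ᵥ y) • v := by
    rw [hM, Matrix.add_mulVec, h.mulVec_eq, zero_add, vecMulVec_mulVec_eq_smul]
  have hvM : v ᵥ* M = (v ⬝ᵥ v) • y := by
    rw [hM, Matrix.vecMul_add, h.vecMul_eq, zero_add, vecMul_vecMulVec_eq_smul]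
  have hMv : M⁻¹ *ᵥ v = (y ⬝ᵥ y)⁻¹ • y := by
    rw [eq_inv_smul_iff₀ hy, ← Matrix.mulVec_smul, ← hMy, Matrix.mulVec_mulVec, hMM',
      Matrix.one_mulVec]
  have hyM : y ᵥ* M⁻¹ = (v ⬝ᵥ v)⁻¹ • v := by
    rw [eq_inv_smul_iff₀ hv, ← Matrix.smul_vecMul, ← hvM, Matrix.vecMul_vecMul, hMM,
      Matrix.vecMul_one]
  -- `M⁻¹` inverts `A` and also sends `v` to a multiple of `y`; the correction removes that part, so
  -- `A X` and `X A` become the orthogonal projections off `v` and off `y`.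
  set X := M⁻¹ - ((v ⬝ᵥ v)⁻¹ * (y ⬝ᵥ y)⁻¹) • vecMulVec y v with hX
  have hAX : A * X = 1 - (v ⬝ᵥ v)⁻¹ • vecMulVec v v := by
    rw [hX, Matrix.mul_sub, Matrix.mul_smul, Matrix.mul_vecMulVec, h.mulVec_eq, zero_vecMulVec,
      smul_zero, sub_zero, show A = M - vecMulVec v y by rw [hM, add_sub_cancel_right],
      Matrix.sub_mul, hMM, Matrix.vecMulVec_mul, hyM, vecMulVec_smul]
  have hXA : X * A = 1 - (y ⬝ᵥ y)⁻¹ • vecMulVec y y := by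
    rw [hX, Matrix.sub_mul, Matrix.smul_mul, Matrix.vecMulVec_mul, h.vecMul_eq, vecMulVec_zero,
      smul_zero, sub_zero, show A = M - vecMulVec v y by rw [hM, add_sub_cancel_right],
      Matrix.mul_sub, hMM', Matrix.mul_vecMulVec, hMv, smul_vecMulVec]
  have hXv : X *ᵥ v = 0 := by
    rw [hX, Matrix.sub_mulVec, hMv, Matrix.smul_mulVec, vecMulVec_mulVec_eq_smul, smul_smul,
      mul_right_comm, inv_mul_cancel₀ hv, one_mul, sub_self]
  refine ⟨X, ⟨?_, ?_, ?_, ?_⟩⟩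
  · rw [hAX, Matrix.sub_mul, Matrix.one_mul, Matrix.smul_mul, Matrix.vecMulVec_mul, h.vecMul_eq,
      vecMulVec_zero, smul_zero, sub_zero]
  · rw [Matrix.mul_assoc, hAX, Matrix.mul_sub, Matrix.mul_one, Matrix.mul_smul,
      Matrix.mul_vecMulVec, hXv, zero_vecMulVec, smul_zero, sub_zero]
  · rw [hAX, Matrix.transpose_sub, Matrix.transpose_one, Matrix.transpose_smul, transpose_vecMulVec]
  · rw [hXA, Matrix.transpose_sub, Matrix.transpose_one, Matrix.transpose_smul, transpose_vecMulVec]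

theorem mul_pinv_mul (h : HasSimpleKernel A y v) : A * pinv A * A = A := by
  rw [pinv, dif_pos h.exists_isMoorePenrose]
  exact h.exists_isMoorePenrose.choose_spec.mul_mul_left

/-- A solution of `A K = Q` depending continuously on the data: `A = M + y vᵀ`, and `vᵀM⁻¹Q` is a
multiple of `vᵀQ = 0`. -/
theorem mul_inv_mul_proj (h : HasSimpleKernel A y v) :
    A * ((A - vecMulVec y v)⁻¹ * proj y v) = proj y v := by
  set M := A - vecMulVec y v with hM
  have hMM : M * M⁻¹ = 1 := Matrix.mul_nonsing_inv M h.isUnit_det_sub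
  have hvM : v ᵥ* M = -((v ⬝ᵥ y) • v) := by
    rw [hM, Matrix.vecMul_sub, h.vecMul_eq, zero_sub, vecMul_vecMulVec_eq_smul]
  have hvM' : v ᵥ* M⁻¹ = -((v ⬝ᵥ y)⁻¹ • v) := by
    have h1 : (v ᵥ* M) ᵥ* M⁻¹ = v := by rw [Matrix.vecMul_vecMul, hMM, Matrix.vecMul_one]
    rw [hvM, Matrix.neg_vecMul, Matrix.smul_vecMul] at h1
    rw [(inv_smul_eq_iff₀ h.dot_ne).2 (show v = (v ⬝ᵥ y) • -(v ᵥ* M⁻¹) by rw [smul_neg, h1]),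
      neg_neg]
  have hvQ : v ᵥ* proj y v = 0 := by
    rw [proj, Matrix.vecMul_sub, Matrix.vecMul_one, Matrix.vecMul_smul, vecMul_vecMulVec_eq_smul,
      smul_smul, inv_mul_cancel₀ h.dot_ne, one_smul, sub_self]
  rw [show A = M + vecMulVec y v by rw [hM, sub_add_cancel], Matrix.add_mul, ← Matrix.mul_assoc,
    hMM, Matrix.one_mul, Matrix.vecMulVec_mul, ← Matrix.vecMul_vecMul, hvM', Matrix.neg_vecMul,
    Matrix.smul_vecMul, hvQ, smul_zero, neg_zero, vecMulVec_zero, add_zero]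

/-- `Q = A K` factors through `A`, and `A A† A = A`. -/
theorem mul_pinv_mul_proj (h : HasSimpleKernel A y v) : A * (pinv A * proj y v) = proj y v := by
  rw [← h.mul_inv_mul_proj]
  simp only [← Matrix.mul_assoc]
  rw [h.mul_pinv_mul]

/-- Matrices annihilating `y` cannot distinguish two solutions `X` of `A X = Q`. -/
theorem mul_eq_mul (h : HasSimpleKernel A y v) {P X Y : Matrix (Fin n) (Fin n) ℝ} (hP : P *ᵥ y = 0)
    (hXY : A * X = A * Y) : P * X = P * Y := by
  rw [← sub_eq_zero, ← Matrix.mul_sub]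
  have hD : A * (X - Y) = 0 := by rw [Matrix.mul_sub, hXY, sub_self]
  refine Matrix.ext_of_mulVec_single fun j => ?_
  obtain ⟨c, hc⟩ := h.ker ((X - Y) *ᵥ Pi.single j 1)
    (by rw [Matrix.mulVec_mulVec, hD, Matrix.zero_mulVec])
  rw [← Matrix.mulVec_mulVec, hc, Matrix.mulVec_smul, hP, smul_zero, Matrix.zero_mulVec]

end HasSimpleKernel

theorem hasSimpleKernel_sub_one [NeZero n] {M : Matrix (Fin n) (Fin n) ℝ} (hM : M.IsIrreducible)
    {u v : Fin n → ℝ} (hu : ∀ i, 0 < u i) (hMu : M *ᵥ u = u) (hv : ∀ i, 0 < v i)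
    (hMv : Mᵀ *ᵥ v = v) : HasSimpleKernel (M - 1) u v where
  mulVec_eq := by rw [Matrix.sub_mulVec, hMu, Matrix.one_mulVec, sub_self]
  vecMul_eq := by rw [Matrix.vecMul_sub, ← Matrix.mulVec_transpose, hMv, Matrix.vecMul_one, sub_self]
  ker x hx := by
    rw [Matrix.sub_mulVec, Matrix.one_mulVec, sub_eq_zero] at hx
    exact exists_eq_smul_of_mulVec_eq_smul hM hu (r := 1) (by rw [hMu, one_smul]) (by rw [hx, one_smul])
  dot_ne := (dotProduct_pos hv hu).ne'

end RankOneKernel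

/-! ### The bilinear operator and the matrices `R` and `H_y`. -/

section Bilinear

variable {n : ℕ} (B : Matrix (Fin n) (Fin n × Fin n) ℝ)

theorem bil_add_right (u v w : Fin n → ℝ) : bil B u (v + w) = bil B u v + bil B u w := by
  simp only [← bilL_mulVec, Matrix.mulVec_add]

theorem bil_sub_right (u v w : Fin n → ℝ) : bil B u (v - w) = bil B u v - bil B u w := by
  simp only [← bilL_mulVec, Matrix.mulVec_sub]

theorem bil_smul_right (c : ℝ) (u v : Fin n → ℝ) : bil B u (c • v) = c • bil B u v := by
  simp only [← bilL_mulVec, Matrix.mulVec_smul]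

theorem bil_add_left (u v w : Fin n → ℝ) : bil B (u + v) w = bil B u w + bil B v w := by
  simp only [← bilR_mulVec, Matrix.mulVec_add]

theorem bil_sub_left (u v w : Fin n → ℝ) : bil B (u - v) w = bil B u w - bil B v w := by
  simp only [← bilR_mulVec, Matrix.mulVec_sub]

theorem bil_smul_left (c : ℝ) (u v : Fin n → ℝ) : bil B (c • u) v = c • bil B u v := by
  simp only [← bilR_mulVec, Matrix.mulVec_smul]

theorem bilL_sub (u v : Fin n → ℝ) : bilL B (u - v) = bilL B u - bilL B v := by
  ext i k
  simp [bilL, mul_sub, Finset.sum_sub_distrib]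

theorem bilR_sub (u v : Fin n → ℝ) : bilR B (u - v) = bilR B u - bilR B v := by
  ext i k
  simp [bilR, mul_sub, Finset.sum_sub_distrib]

theorem bilR_smul (c : ℝ) (u : Fin n → ℝ) : bilR B (c • u) = c • bilR B u := by
  ext i k
  simp only [bilR, Matrix.of_apply, Pi.smul_apply, smul_eq_mul, Matrix.smul_apply, Finset.mul_sum]
  exact Finset.sum_congr rfl fun j _ => by ring

theorem matR_mulVec (u : Fin n → ℝ) : matR B *ᵥ u = bil B 1 u + bil B u 1 := by
  rw [matR, Matrix.add_mulVec, bilL_mulVec, bilR_mulVec]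

theorem matH_mulVec (y u : Fin n → ℝ) : matH B y *ᵥ u = bil B u 1 + bil B 1 u - bil B y u := by
  rw [matH, Matrix.sub_mulVec, Matrix.add_mulVec, bilL_mulVec, bilR_mulVec, bilL_mulVec]

theorem matH_eq (y : Fin n → ℝ) : matH B y = bilL B (1 - y) + bilR B 1 := by
  rw [matH, bilL_sub]
  abel

theorem matH_zero : matH B 0 = matR B := by
  rw [matH_eq, sub_zero, matR]

variable {B}

theorem bil_mono (hB : ∀ i p, 0 ≤ B i p) {u u' v v' : Fin n → ℝ} (hu : 0 ≤ u) (huu : u ≤ u')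
    (hv : 0 ≤ v) (hvv : v ≤ v') : bil B u v ≤ bil B u' v' := fun i => by
  simp only [bil, Matrix.mulVec, dotProduct]
  exact Finset.sum_le_sum fun p _ => mul_le_mul_of_nonneg_left
    (mul_le_mul (huu _) (hvv _) (hv _) ((hu _).trans (huu _))) (hB i p)

theorem bil_nonneg (hB : ∀ i p, 0 ≤ B i p) {u v : Fin n → ℝ} (hu : 0 ≤ u) (hv : 0 ≤ v) :
    0 ≤ bil B u v := fun i => by
  simp only [bil, Matrix.mulVec, dotProduct]
  exact Finset.sum_nonneg fun p _ => mul_nonneg (hB i p) (mul_nonneg (hu _) (hv _))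

theorem bilL_nonneg (hB : ∀ i p, 0 ≤ B i p) {u : Fin n → ℝ} (hu : 0 ≤ u) (i j : Fin n) :
    0 ≤ bilL B u i j := by
  rw [bilL, Matrix.of_apply]
  exact Finset.sum_nonneg fun _ _ => mul_nonneg (hB i _) (hu _)

theorem bilR_nonneg (hB : ∀ i p, 0 ≤ B i p) {u : Fin n → ℝ} (hu : 0 ≤ u) (i j : Fin n) :
    0 ≤ bilR B u i j := by
  rw [bilR, Matrix.of_apply]
  exact Finset.sum_nonneg fun _ _ => mul_nonneg (hB i _) (hu _)

theorem matH_nonneg (hB : ∀ i p, 0 ≤ B i p) {y : Fin n → ℝ} (hy : y ≤ 1) (i j : Fin n) :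
    0 ≤ matH B y i j := by
  rw [matH_eq]
  exact add_nonneg (bilL_nonneg hB (sub_nonneg.2 hy) i j) (bilR_nonneg hB zero_le_one i j)

/-- When `1 - y` is positive, `b(1 - y, ·)` has the same positive entries as `b(1, ·)`, so no edge
of the graph of `R` is lost. -/
theorem matH_isIrreducible (hB : ∀ i p, 0 ≤ B i p) (hirr : (matR B).IsIrreducible) {y : Fin n → ℝ}
    (hy : ∀ i, y i < 1) : (matH B y).IsIrreducible := by
  refine isIrreducible_of_pos_of_pos hirr (matH_nonneg hB fun i => (hy i).le) fun i k h => ?_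
  have hL : 0 ≤ bilL B (1 - y) i k := bilL_nonneg hB (sub_nonneg.2 fun i => (hy i).le) i k
  have hR := bilR_nonneg hB zero_le_one i k
  rw [matH_eq, Matrix.add_apply]
  rw [matR, Matrix.add_apply] at h
  rcases hR.eq_or_lt with h0 | h0
  · rw [← h0, add_zero] at h ⊢
    simp only [bilL, Matrix.of_apply, Pi.one_apply, mul_one] at h
    obtain ⟨j, hj, hpos⟩ := (Finset.sum_pos_iff_of_nonneg fun j _ => hB i (j, k)).1 h
    simp only [bilL, Matrix.of_apply]
    refine (Finset.sum_pos_iff_of_nonneg fun j _ =>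
      mul_nonneg (hB i (j, k)) (sub_nonneg.2 (hy j).le)).2 ⟨j, hj, mul_pos hpos (sub_pos.2 (hy j))⟩
  · exact add_pos_of_nonneg_of_pos hL h0

theorem dotProduct_bil_pos (hB : ∀ i p, 0 ≤ B i p) (hB0 : B ≠ 0) {w y : Fin n → ℝ}
    (hw : ∀ i, 0 < w i) (hy : ∀ i, 0 < y i) : 0 < w ⬝ᵥ bil B y y := by
  have hb : ∀ i, 0 ≤ bil B y y i := bil_nonneg hB (fun i => (hy i).le) fun i => (hy i).le
  refine lt_of_le_of_ne (Finset.sum_nonneg fun i _ => mul_nonneg (hw i).le (hb i)) fun h0 => hB0 ?_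
  ext i p
  have h1 := (Finset.sum_eq_zero_iff_of_nonneg fun i _ => mul_nonneg (hw i).le (hb i)).1 h0.symm i
    (Finset.mem_univ i)
  have h2 := (mul_eq_zero.1 h1).resolve_left (hw i).ne'
  have h3 := (Finset.sum_eq_zero_iff_of_nonneg fun p _ =>
    mul_nonneg (hB i p) (mul_pos (hy p.1) (hy p.2)).le).1 h2 p (Finset.mem_univ p)
  exact (mul_eq_zero.1 h3).resolve_right (mul_pos (hy p.1) (hy p.2)).ne'

theorem specRad_zero : specRad (0 : Matrix (Fin n) (Fin n) ℝ) = 0 := by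
  rw [specRad, show (0 : Matrix (Fin n) (Fin n) ℝ).map ((↑) : ℝ → ℂ) = 0 by ext; simp]
  simp

theorem matR_ne_zero (h : 1 ≤ specRad (matR B)) : matR B ≠ 0 := fun h0 => by
  rw [h0, specRad_zero] at h
  exact absurd h (by norm_num)

theorem ne_zero_of_one_le_specRad (h : 1 ≤ specRad (matR B)) : B ≠ 0 := by
  rintro rfl
  refine matR_ne_zero h ?_
  ext i j
  simp [matR, bilL, bilR]

theorem neZero_of_one_le_specRad (h : 1 ≤ specRad (matR B)) : NeZero n :=
  ⟨by
    rintro rfl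
    exact matR_ne_zero h (Subsingleton.elim _ _)⟩

end Bilinear

/-! ### Extinction and survival vectors. -/

section Extinction

variable {n : ℕ} {a : Fin n → ℝ} {B : Matrix (Fin n) (Fin n × Fin n) ℝ}

/-- The nonnegative vectors `x` with `a + b(x,x) ≤ x`. -/
def supersolutions (a : Fin n → ℝ) (B : Matrix (Fin n) (Fin n × Fin n) ℝ) : Set (Fin n → ℝ) :=
  {x | 0 ≤ x ∧ a + bil B x x ≤ x}

/-- Knaster–Tarski: by monotonicity the infimum `s` is a supersolution, hence so is `a + b(s,s)`,
which gives the reverse inequality. -/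
theorem sInf_supersolutions_mem (h : IsMBT a B) :
    sInf (supersolutions a B) ∈ solutions a B := by
  have hne : (supersolutions a B).Nonempty := ⟨1, zero_le_one, h.one_eq.symm.le⟩
  have hbdd : BddBelow (supersolutions a B) := ⟨0, fun x hx => hx.1⟩
  set s := sInf (supersolutions a B) with hs
  have h0 : 0 ≤ s := le_csInf hne fun x hx => hx.1
  have h1 : a + bil B s s ≤ s := le_csInf hne fun x hx =>
    (add_le_add_right (bil_mono h.B_nonneg h0 (csInf_le hbdd hx) h0 (csInf_le hbdd hx)) a).trans hx.2
  have h2 : 0 ≤ a + bil B s s := add_nonneg h.a_nonneg (bil_nonneg h.B_nonneg h0 h0)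
  exact ⟨h0, le_antisymm (csInf_le hbdd
    ⟨h2, add_le_add_right (bil_mono h.B_nonneg h2 h1 h2 h1) a⟩) h1⟩

theorem extinction_eq_sInf (h : IsMBT a B) : extinction a B = sInf (supersolutions a B) := by
  have hbdd : BddBelow (supersolutions a B) := ⟨0, fun x hx => hx.1⟩
  have hl : IsLeast (solutions a B) (sInf (supersolutions a B)) :=
    ⟨sInf_supersolutions_mem h, fun x hx => csInf_le hbdd ⟨hx.1, hx.2.symm.le⟩⟩
  have hex : ∃ x, IsLeast (solutions a B) x := ⟨_, hl⟩
  rw [extinction, dif_pos hex]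
  exact hex.choose_spec.unique hl

theorem extinction_mem (h : IsMBT a B) : extinction a B ∈ solutions a B := by
  rw [extinction_eq_sInf h]
  exact sInf_supersolutions_mem h

theorem extinction_le (h : IsMBT a B) {x : Fin n → ℝ} (hx : x ∈ supersolutions a B) :
    extinction a B ≤ x := by
  rw [extinction_eq_sInf h]
  exact csInf_le ⟨0, fun x hx => hx.1⟩ hx

theorem survival_nonneg (h : IsMBT a B) : 0 ≤ survival a B :=
  sub_nonneg.2 (extinction_le h ⟨zero_le_one, h.one_eq.symm.le⟩)

theorem survival_le_one (h : IsMBT a B) : survival a B ≤ 1 :=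
  sub_le_self _ (extinction_mem h).1

theorem matH_mulVec_survival (h : IsMBT a B) :
    matH B (survival a B) *ᵥ survival a B = survival a B := by
  have hx : extinction a B = 1 - survival a B := by rw [survival, sub_sub_cancel]
  have h1 := (extinction_mem h).2
  rw [hx] at h1
  have h3 := h.one_eq
  rw [matH_mulVec]
  simp only [bil_sub_left, bil_sub_right] at h1
  linear_combination h1 - h3

theorem exists_specRad_smul_le_mulVec [NeZero n] {M : Matrix (Fin n) (Fin n) ℝ}
    (hM : ∀ i j, 0 ≤ M i j) : ∃ u : Fin n → ℝ, 0 ≤ u ∧ u ≠ 0 ∧ specRad M • u ≤ M *ᵥ u := by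
  obtain ⟨μ, hμ, hr⟩ := exists_eigenvalue_norm_eq_specRad M
  obtain ⟨x, hx0, hx⟩ := (mem_spectrum_iff_exists_mulVec _ _).1 hμ
  refine ⟨fun i => ‖x i‖, fun i => norm_nonneg _, fun h0 => hx0 ?_, fun i => ?_⟩
  · exact funext fun i => norm_eq_zero.1 (congrFun h0 i)
  · rw [← hr]
    exact norm_mul_norm_le_mulVec_norm hM hx i

theorem matR_nonneg (hB : ∀ i p, 0 ≤ B i p) (i j : Fin n) : 0 ≤ matR B i j := by
  rw [← matH_zero]
  exact matH_nonneg hB zero_le_one i j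

/-- With `r u ≤ R u` and `r > 1`, the vector `1 - ε u` is a supersolution for small `ε`: the
first-order gain `ε(Ru - u)` dominates `ε² b(u,u)`. Extinction is therefore below one somewhere. -/
theorem survival_ne_zero (h : IsMBT a B) (hs : IsSupercritical B) : survival a B ≠ 0 := by
  have : NeZero n := neZero_of_one_le_specRad (le_of_lt hs)
  obtain ⟨u, hu, hu0, hle⟩ := exists_specRad_smul_le_mulVec (matR_nonneg h.B_nonneg)
  set r := specRad (matR B)
  have hr : 1 < r := hs
  obtain ⟨k, hk⟩ := Finite.exists_max u
  have huk : 0 < u k := by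
    obtain ⟨j, hj⟩ := Function.ne_iff.1 hu0
    exact (lt_of_le_of_ne (hu j) (Ne.symm hj)).trans_le (hk j)
  set m := u k
  have hum : u ≤ m • (1 : Fin n → ℝ) := fun i => by simpa using hk i
  -- Chosen so that `ε b(u,u) ≤ ε m Ru = (1 - r⁻¹) Ru ≤ Ru - u`.
  set ε := (1 - r⁻¹) / m with hε
  have hr' : 0 < 1 - r⁻¹ := sub_pos.2 (inv_lt_one_of_one_lt₀ hr)
  have hε0 : 0 < ε := div_pos hr' huk
  have hεm : ε * m = 1 - r⁻¹ := div_mul_cancel₀ _ huk.ne'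
  have hmem : 1 - ε • u ∈ supersolutions a B := by
    refine ⟨fun i => ?_, fun i => ?_⟩
    · have h1 : ε * u i ≤ ε * m := mul_le_mul_of_nonneg_left (hk i) hε0.le
      have h2 : 0 < r⁻¹ := inv_pos.2 (zero_lt_one.trans hr)
      simp only [Pi.zero_apply, Pi.sub_apply, Pi.one_apply, Pi.smul_apply, smul_eq_mul]
      linarith
    · have hb : bil B u u i ≤ m * (matR B *ᵥ u) i := by
        have h1 := bil_mono h.B_nonneg hu hum hu le_rfl i
        rw [bil_smul_left, Pi.smul_apply, smul_eq_mul] at h1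
        have h2 : 0 ≤ bil B u 1 i := bil_nonneg h.B_nonneg hu zero_le_one i
        rw [matR_mulVec, Pi.add_apply]
        nlinarith
      have hu' : u i ≤ r⁻¹ * (matR B *ᵥ u) i := by
        rw [le_inv_mul_iff₀ (zero_lt_one.trans hr)]
        exact hle i
      have hexp : a + bil B (1 - ε • u) (1 - ε • u) =
          1 - ε • (matR B *ᵥ u) + (ε * ε) • bil B u u := by
        conv_rhs => rw [h.one_eq]
        simp only [bil_sub_left, bil_sub_right, bil_smul_left, bil_smul_right, matR_mulVec]
        module
      rw [hexp]
      simp only [Pi.add_apply, Pi.sub_apply, Pi.one_apply, Pi.smul_apply, smul_eq_mul]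
      have h3 : ε * bil B u u i ≤ ε * (m * (matR B *ᵥ u) i) := mul_le_mul_of_nonneg_left hb hε0.le
      have h4 : ε * u i ≤ ε * ((matR B *ᵥ u) i - ε * bil B u u i) := by
        refine mul_le_mul_of_nonneg_left ?_ hε0.le
        rw [← mul_assoc, hεm] at h3
        linarith
      linarith
  intro h0
  have h1 := extinction_le h hmem k
  have h2 : extinction a B k = 1 := by
    have := congrFun h0 k
    simp only [survival, Pi.sub_apply, Pi.one_apply, Pi.zero_apply] at this
    linarith
  rw [h2] at h1
  simp only [Pi.sub_apply, Pi.one_apply, Pi.smul_apply, smul_eq_mul] at h1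
  have := mul_pos hε0 huk
  linarith

/-- In the critical irreducible case the equation `y = H_y y` has no nonzero nonnegative solution. -/
theorem eq_zero_of_matH_mulVec_eq (hB : ∀ i p, 0 ≤ B i p) (hB0 : B ≠ 0)
    (hirr : (matR B).IsIrreducible) {v : Fin n → ℝ} (hv : ∀ i, 0 < v i) (hvR : (matR B)ᵀ *ᵥ v = v)
    {y : Fin n → ℝ} (hy : 0 ≤ y) (h : matH B y *ᵥ y = y) : y = 0 := by
  have h1 : matR B *ᵥ y - bil B y y = y := by
    conv_rhs => rw [← h]
    rw [matR_mulVec, matH_mulVec, add_comm]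
  -- Pairing with the left fixed vector of `R` cancels the linear terms.
  have h2 : v ⬝ᵥ bil B y y = 0 := by
    have := congrArg (v ⬝ᵥ ·) h1
    simp only [dotProduct_sub] at this
    rw [Matrix.dotProduct_mulVec, ← Matrix.mulVec_transpose, hvR] at this
    linarith
  have h3 : bil B y y = 0 := funext fun i => (mul_eq_zero.1
    ((Finset.sum_eq_zero_iff_of_nonneg fun i _ =>
      mul_nonneg (hv i).le (bil_nonneg hB hy hy i)).1 h2 i (Finset.mem_univ i))).resolve_left (hv i).ne'
  rw [h3, sub_zero] at h1
  by_contra hne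
  exact (dotProduct_bil_pos hB hB0 hv
    (pos_of_mulVec_eq_smul hirr hy hne (r := 1) (by rw [h1, one_smul]))).ne' h2

end Extinction

/-! ### Differentiability of the Perron map by the implicit function theorem. -/

section Jacobian

variable {n : ℕ} {B : Matrix (Fin n) (Fin n × Fin n) ℝ} {w y : Fin n → ℝ}

theorem perronVector_transpose_spec [NeZero n] {M : Matrix (Fin n) (Fin n) ℝ}
    (hM : M.IsIrreducible) {u : Fin n → ℝ} (hu : ∀ i, 0 < u i) (h : M *ᵥ u = u) :
    (∀ i, 0 < perronVector Mᵀ i) ∧ Mᵀ *ᵥ perronVector Mᵀ = perronVector Mᵀ ∧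
      ∑ i, perronVector Mᵀ i = 1 := by
  obtain ⟨v, hv, hMv⟩ := exists_pos_left_eigenvector hM hu h
  have hs := sum_pos_of_pos hv
  rw [perronVector_eq hM.transpose hv (r := 1) (by rw [hMv, one_smul])]
  refine ⟨fun i => mul_pos (inv_pos.2 hs) (hv i), by rw [Matrix.mulVec_smul, hMv], ?_⟩
  simp only [Pi.smul_apply, smul_eq_mul, ← Finset.mul_sum, inv_mul_cancel₀ hs.ne']

/-- The row vector `σᵀ` in the Jacobian of the Perron iteration. -/
def sigma (B : Matrix (Fin n) (Fin n × Fin n) ℝ) (w y : Fin n → ℝ) : Fin n → ℝ :=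
  w ᵥ* (1 - bilL B (1 - y) - bilR B (1 - y))

/-- The right side is the derivative at `z = y`, in direction `x`, of the normalization `wᵀ(z - Rz +
b(z,z))`. -/
theorem sigma_dotProduct (B : Matrix (Fin n) (Fin n × Fin n) ℝ) (w y x : Fin n → ℝ) :
    sigma B w y ⬝ᵥ x = w ⬝ᵥ (x - bil B x 1 - bil B 1 x + bil B x y + bil B y x) := by
  rw [sigma, ← Matrix.dotProduct_mulVec, Matrix.sub_mulVec, Matrix.sub_mulVec, Matrix.one_mulVec,
    bilL_mulVec, bilR_mulVec, bil_sub_left, bil_sub_right]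
  congr 1
  abel

theorem sigma_dotProduct_self (hfix : matH B y *ᵥ y = y) :
    sigma B w y ⬝ᵥ y = w ⬝ᵥ bil B y y := by
  rw [sigma_dotProduct]
  rw [matH_mulVec] at hfix
  congr 1
  linear_combination -hfix

/-- The projection along `y` onto the orthogonal complement of `σ`. -/
noncomputable def projSigma (B : Matrix (Fin n) (Fin n × Fin n) ℝ) (w y : Fin n → ℝ) :
    Matrix (Fin n) (Fin n) ℝ :=
  1 - (w ⬝ᵥ bil B y y)⁻¹ • vecMulVec y (sigma B w y)

theorem projSigma_mulVec (hfix : matH B y *ᵥ y = y) (hc : w ⬝ᵥ bil B y y ≠ 0) :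
    projSigma B w y *ᵥ y = 0 := by
  rw [projSigma, Matrix.sub_mulVec, Matrix.one_mulVec, Matrix.smul_mulVec, vecMulVec_mulVec_eq_smul,
    sigma_dotProduct_self hfix, smul_smul, inv_mul_cancel₀ hc, one_smul, sub_self]

theorem sigma_vecMul_projSigma (hfix : matH B y *ᵥ y = y) (hc : w ⬝ᵥ bil B y y ≠ 0) :
    sigma B w y ᵥ* projSigma B w y = 0 := by
  rw [projSigma, Matrix.vecMul_sub, Matrix.vecMul_one, Matrix.vecMul_smul, vecMul_vecMulVec_eq_smul,
    sigma_dotProduct_self hfix, smul_smul, inv_mul_cancel₀ hc, one_smul, sub_self]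

theorem jacobian_eq (B : Matrix (Fin n) (Fin n × Fin n) ℝ) (w y : Fin n → ℝ) :
    jacobian B w y = projSigma B w y * (pinv (matH B y - 1) * proj y (perronVector (matH B y)ᵀ)) *
      bilR B y := by
  simp only [jacobian, projSigma, sigma, proj, matH_eq, Matrix.mul_assoc]

/-- A positive fixed vector `y < 1` of `H_y`, for irreducible `R`. -/
structure IsSurvivalVector (B : Matrix (Fin n) (Fin n × Fin n) ℝ) (y : Fin n → ℝ) : Prop where
  B_nonneg : ∀ i p, 0 ≤ B i p
  B_ne_zero : B ≠ 0
  irr : (matR B).IsIrreducible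
  pos : ∀ i, 0 < y i
  lt_one : ∀ i, y i < 1
  fix : matH B y *ᵥ y = y

namespace IsSurvivalVector

theorem hasSimpleKernel [NeZero n] (h : IsSurvivalVector B y) :
    HasSimpleKernel (matH B y - 1) y (perronVector (matH B y)ᵀ) := by
  have hirr := matH_isIrreducible h.B_nonneg h.irr h.lt_one
  obtain ⟨hv, hMv, -⟩ := perronVector_transpose_spec hirr h.pos h.fix
  exact hasSimpleKernel_sub_one hirr h.pos h.fix hv hMv

/-- With `mulVec_jacobian`, this shows that the Jacobian solves the linearized equations; it fixes
the component along `y` that `A` leaves free. -/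
theorem sigma_dotProduct_jacobian (h : IsSurvivalVector B y) (hw : ∀ i, 0 < w i)
    (x : Fin n → ℝ) : sigma B w y ⬝ᵥ (jacobian B w y *ᵥ x) = 0 := by
  rw [jacobian_eq, Matrix.mul_assoc, ← Matrix.mulVec_mulVec, Matrix.dotProduct_mulVec,
    sigma_vecMul_projSigma h.fix (dotProduct_bil_pos h.B_nonneg h.B_ne_zero hw h.pos).ne',
    zero_dotProduct]

theorem mulVec_jacobian [NeZero n] (h : IsSurvivalVector B y) (x : Fin n → ℝ) :
    (matH B y - 1) *ᵥ (jacobian B w y *ᵥ x) =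
      proj y (perronVector (matH B y)ᵀ) *ᵥ bil B x y := by
  have hA := h.hasSimpleKernel
  have hAP : (matH B y - 1) * projSigma B w y = matH B y - 1 := by
    rw [projSigma, Matrix.mul_sub, Matrix.mul_one, Matrix.mul_smul, Matrix.mul_vecMulVec,
      hA.mulVec_eq, zero_vecMulVec, smul_zero, sub_zero]
  rw [jacobian_eq, Matrix.mulVec_mulVec, ← Matrix.mul_assoc, ← Matrix.mul_assoc, hAP,
    hA.mul_pinv_mul_proj, ← Matrix.mulVec_mulVec, bilR_mulVec]

end IsSurvivalVector

/-- The bilinear operator `b` as a continuous bilinear map. -/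
noncomputable def bilCLM (B : Matrix (Fin n) (Fin n × Fin n) ℝ) :
    (Fin n → ℝ) →L[ℝ] (Fin n → ℝ) →L[ℝ] (Fin n → ℝ) :=
  (LinearMap.mk₂ ℝ (bil B) (bil_add_left B) (bil_smul_left B) (bil_add_right B)
    (bil_smul_right B)).toContinuousBilinearMap

theorem bilCLM_apply (B : Matrix (Fin n) (Fin n × Fin n) ℝ) (u v : Fin n → ℝ) :
    bilCLM B u v = bil B u v := rfl

/-- The linear form `x ↦ wᵀ x`. -/
noncomputable def dotCLM (w : Fin n → ℝ) : (Fin n → ℝ) →L[ℝ] ℝ :=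
  LinearMap.toContinuousLinearMap (dotProductBilin ℝ ℝ w)

theorem dotCLM_apply (w x : Fin n → ℝ) : dotCLM w x = w ⬝ᵥ x := rfl

/-- The equations `H_y z = r z` and `wᵀ (z - R z + b(z,z)) = 0` that determine `z = F(y)`. -/
def perronEquation (B : Matrix (Fin n) (Fin n × Fin n) ℝ) (w : Fin n → ℝ)
    (p : (Fin n → ℝ) × ((Fin n → ℝ) × ℝ)) : (Fin n → ℝ) × ℝ :=
  (matH B p.1 *ᵥ p.2.1 - p.2.2 • p.2.1,
    w ⬝ᵥ (p.2.1 - bil B p.2.1 1 - bil B 1 p.2.1 + bil B p.2.1 p.2.1))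

theorem hasStrictFDerivAt_perronEquation (B : Matrix (Fin n) (Fin n × Fin n) ℝ) (w y : Fin n → ℝ) :
    ∃ D : ((Fin n → ℝ) × ((Fin n → ℝ) × ℝ)) →L[ℝ] ((Fin n → ℝ) × ℝ),
      HasStrictFDerivAt (perronEquation B w) D (y, (y, 1)) ∧
      ∀ x z r, D (x, (z, r)) =
        ((matH B y - 1) *ᵥ z - bil B x y - r • y, sigma B w y ⬝ᵥ z) := by
  set q : (Fin n → ℝ) × ((Fin n → ℝ) × ℝ) := (y, (y, 1))
  have h1 : HasStrictFDerivAt (fun p : (Fin n → ℝ) × ((Fin n → ℝ) × ℝ) => p.1)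
      (ContinuousLinearMap.fst ℝ (Fin n → ℝ) ((Fin n → ℝ) × ℝ)) q :=
    hasStrictFDerivAt_fst
  have h2 : HasStrictFDerivAt (fun p : (Fin n → ℝ) × ((Fin n → ℝ) × ℝ) => p.2.1)
      (ContinuousLinearMap.fst ℝ (Fin n → ℝ) ℝ ∘L
        ContinuousLinearMap.snd ℝ (Fin n → ℝ) ((Fin n → ℝ) × ℝ)) q :=
    (hasStrictFDerivAt_snd (𝕜 := ℝ) (p := q)).fst
  have h3 : HasStrictFDerivAt (fun p : (Fin n → ℝ) × ((Fin n → ℝ) × ℝ) => p.2.2)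
      (ContinuousLinearMap.snd ℝ (Fin n → ℝ) ℝ ∘L
        ContinuousLinearMap.snd ℝ (Fin n → ℝ) ((Fin n → ℝ) × ℝ)) q :=
    (hasStrictFDerivAt_snd (𝕜 := ℝ) (p := q)).snd
  have hc := hasStrictFDerivAt_const (𝕜 := ℝ) (1 : Fin n → ℝ) q
  have b1 := (bilCLM B).hasStrictFDerivAt_of_bilinear h2 hc
  have b2 := (bilCLM B).hasStrictFDerivAt_of_bilinear hc h2
  have b3 := (bilCLM B).hasStrictFDerivAt_of_bilinear h1 h2
  have b4 := (bilCLM B).hasStrictFDerivAt_of_bilinear h2 h2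
  have hfst := ((b1.add b2).sub b3).sub (h3.smul h2)
  have hsnd := (dotCLM w).hasStrictFDerivAt.comp q (((h2.sub b1).sub b2).add b4)
  refine ⟨_, (hfst.prodMk hsnd).congr_of_eventuallyEq (Eventually.of_forall fun p => ?_), ?_⟩
  · simp [perronEquation, matH_mulVec, bilCLM_apply, dotCLM_apply]
  · intro x z r
    rw [sigma_dotProduct, Matrix.sub_mulVec, matH_mulVec, Matrix.one_mulVec]
    simp only [q, ContinuousLinearMap.prod_apply, _root_.sub_apply,
      _root_.add_apply, ContinuousLinearMap.comp_apply,
      ContinuousLinearMap.precompR_apply, ContinuousLinearMap.precompL_apply, bilCLM_apply,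
      dotCLM_apply, ContinuousLinearMap.coe_fst', ContinuousLinearMap.coe_snd',
      _root_.zero_apply, ContinuousLinearMap.compL_apply,
      ContinuousLinearMap.smulRight_apply, one_smul, map_zero, zero_add, add_zero]
    refine Prod.ext ?_ ?_
    · simp only []
      abel
    · simp only []
      congr 1
      abel

/-- A positive eigenvector is automatically a Perron vector, and the normalization equation then
forces the scaling `α`. -/
theorem perronMap_eq [NeZero n] (hB : ∀ i p, 0 ≤ B i p) (hB0 : B ≠ 0)
    (hirr : (matR B).IsIrreducible) (hw : ∀ i, 0 < w i) {x z : Fin n → ℝ} {r : ℝ}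
    (hx : ∀ i, x i < 1) (hz : ∀ i, 0 < z i) (h : perronEquation B w (x, (z, r)) = 0) :
    perronMap B w x = z := by
  obtain ⟨h1, h2⟩ := Prod.ext_iff.1 h
  simp only [perronEquation, Prod.fst_zero, Prod.snd_zero] at h1 h2
  have hs := sum_pos_of_pos hz
  have hd := dotProduct_bil_pos hB hB0 hw hz
  rw [dotProduct_add] at h2
  rw [perronMap, perronVector_eq (matH_isIrreducible hB hirr hx) hz (sub_eq_zero.1 h1)]
  simp only [bil_smul_left, bil_smul_right, ← smul_sub, dotProduct_smul, smul_smul, smul_eq_mul]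
  rw [eq_neg_of_add_eq_zero_left h2]
  have : -((∑ i, z i)⁻¹ * -(w ⬝ᵥ bil B z z)) / ((∑ i, z i)⁻¹ * (∑ i, z i)⁻¹ * w ⬝ᵥ bil B z z) *
      (∑ i, z i)⁻¹ = 1 := by
    field_simp
  rw [this, one_smul]

theorem IsSurvivalVector.hasFDerivAt_perronMap [NeZero n] (h : IsSurvivalVector B y)
    (hw : ∀ i, 0 < w i) :
    HasFDerivAt (perronMap B w)
      (LinearMap.toContinuousLinearMap (Matrix.toLin' (jacobian B w y))) y := by
  obtain ⟨D, hD, hDapp⟩ := hasStrictFDerivAt_perronEquation B w y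
  have hA := h.hasSimpleKernel
  have hpos := dotProduct_bil_pos h.B_nonneg h.B_ne_zero hw h.pos
  set v := perronVector (matH B y)ᵀ
  -- Pairing with `v` gives `r = 0`, so `z` lies on the line of `y`, where `σ` is injective.
  have hinj : Function.Injective (D ∘L .inr ℝ (Fin n → ℝ) ((Fin n → ℝ) × ℝ)) := by
    refine (injective_iff_map_eq_zero _).2 ?_
    rintro ⟨z, r⟩ hz
    rw [ContinuousLinearMap.comp_apply, ContinuousLinearMap.inr_apply, hDapp, Prod.mk_eq_zero] at hz
    obtain ⟨h1, h2⟩ := hz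
    rw [← zero_smul ℝ (0 : Fin n → ℝ), bil_smul_left, zero_smul, sub_zero] at h1
    have h3 : v ⬝ᵥ ((matH B y - 1) *ᵥ z - r • y) = 0 := by rw [h1, zero_smul, dotProduct_zero]
    rw [dotProduct_sub, Matrix.dotProduct_mulVec, hA.vecMul_eq, zero_dotProduct, zero_sub,
      neg_eq_zero, dotProduct_smul, smul_eq_mul, mul_eq_zero, or_iff_left hA.dot_ne] at h3
    rw [h3, zero_smul, sub_zero, zero_smul] at h1
    obtain ⟨c, rfl⟩ := hA.ker z h1
    rw [dotProduct_smul, sigma_dotProduct_self h.fix, smul_eq_mul, mul_eq_zero,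
      or_iff_left hpos.ne'] at h2
    rw [h2, h3, zero_smul, Prod.mk_zero_zero]
  have hinv : (D ∘L .inr ℝ (Fin n → ℝ) ((Fin n → ℝ) × ℝ)).IsInvertible :=
    ⟨(LinearEquiv.ofInjectiveEndo _ hinj).toContinuousLinearEquiv, ContinuousLinearMap.ext fun _ => rfl⟩
  set φ := hD.implicitFunctionOfProdDomain hinv with hφ
  have hφ' := hD.hasStrictFDerivAt_implicitFunctionOfProdDomain hinv
  have hφt := hD.tendsto_implicitFunctionOfProdDomain hinv
  have hφe := hD.eventually_apply_implicitFunctionOfProdDomain hinv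
  rw [← hφ] at hφ' hφt hφe
  have hzero : perronEquation B w (y, (y, 1)) = 0 := by
    simp only [perronEquation, h.fix, one_smul, sub_self]
    have h2 : y - bil B y 1 - bil B 1 y + bil B y y = 0 := by
      have := h.fix
      rw [matH_mulVec] at this
      linear_combination -this
    rw [h2, dotProduct_zero, Prod.mk_zero_zero]
  -- The implicit solution stays positive near `y`, so it is the Perron map.
  have hev : perronMap B w =ᶠ[𝓝 y] fun x => (φ x).1 := by
    have hlt : ∀ᶠ x : Fin n → ℝ in 𝓝 y, ∀ i, x i < 1 := eventually_all.2 fun i =>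
      (continuous_apply i).continuousAt.eventually_lt_const (h.lt_one i)
    have hgt : ∀ᶠ x in 𝓝 y, ∀ i, 0 < (φ x).1 i := eventually_all.2 fun i =>
      Tendsto.eventually_const_lt (h.pos i) (((continuous_apply i).comp continuous_fst).continuousAt.tendsto.comp hφt)
    filter_upwards [hlt, hgt, hφe] with x hx1 hx2 hx3
    exact perronMap_eq (r := (φ x).2) h.B_nonneg h.B_ne_zero h.irr hw hx1 hx2 (hx3.trans hzero)
  refine (hφ'.hasFDerivAt.fst.congr_of_eventuallyEq hev).congr_fderiv ?_
  ext1 x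
  set J := jacobian B w y with hJ
  -- The scalar `-vᵀb(x,y) / vᵀy` is the first-order change of the Perron root; it supplies the
  -- `y`-component removed by `proj`.
  have hinvx : (D ∘L .inr ℝ (Fin n → ℝ) ((Fin n → ℝ) × ℝ)).inverse
      ((D ∘L .inl ℝ (Fin n → ℝ) ((Fin n → ℝ) × ℝ)) x) =
      -(J *ᵥ x, -((v ⬝ᵥ y)⁻¹ * (v ⬝ᵥ bil B x y))) := by
    rw [hinv.inverse_apply_eq, ContinuousLinearMap.map_neg, eq_neg_iff_add_eq_zero]
    rw [ContinuousLinearMap.comp_apply, ContinuousLinearMap.comp_apply, ← map_add,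
      ContinuousLinearMap.inl_apply, ContinuousLinearMap.inr_apply, Prod.mk_add_mk, add_zero,
      zero_add, hDapp, h.sigma_dotProduct_jacobian hw, h.mulVec_jacobian, proj, Matrix.sub_mulVec,
      Matrix.one_mulVec, Matrix.smul_mulVec, vecMulVec_mulVec_eq_smul, Prod.mk_eq_zero]
    refine ⟨?_, rfl⟩
    module
  change (-((D ∘L .inr ℝ (Fin n → ℝ) ((Fin n → ℝ) × ℝ)).inverse
      ((D ∘L .inl ℝ (Fin n → ℝ) ((Fin n → ℝ) × ℝ)) x))).1 = J *ᵥ x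
  rw [hinvx, neg_neg]

end Jacobian

/-! ### The Jacobian as the survival vector shrinks to zero. -/

section Limit

variable {n : ℕ}

theorem proj_smul_left (y v : Fin n → ℝ) {s : ℝ} (hs : s ≠ 0) : proj (s • y) v = proj y v := by
  rw [proj, proj, smul_vecMulVec, dotProduct_smul, smul_smul, smul_eq_mul, mul_inv, mul_right_comm,
    inv_mul_cancel₀ hs, one_mul]

/-- The Jacobian at `y = s z`, written so that the limit `s → 0` can be taken. -/
theorem IsSurvivalVector.jacobian_eq_of_eq_smul [NeZero n]
    {B : Matrix (Fin n) (Fin n × Fin n) ℝ} {w y z v : Fin n → ℝ} {s : ℝ} (h : IsSurvivalVector B y)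
    (hw : ∀ i, 0 < w i) (hs : s ≠ 0) (hyz : y = s • z) (hv : v = perronVector (matH B y)ᵀ)
    {K : Matrix (Fin n) (Fin n) ℝ} (hK : K = (matH B y - 1 - vecMulVec z v)⁻¹ * proj z v) :
    jacobian B w y = s • (K * bilR B z) - (w ⬝ᵥ bil B z z)⁻¹ •
      vecMulVec z (w ᵥ* (s • (bilR B z * (K * bilR B z)) - proj z v * bilR B z)) := by
  have hA := h.hasSimpleKernel
  rw [← hv] at hA
  have hAz : HasSimpleKernel (matH B y - 1) z v := by
    refine ⟨?_, hA.vecMul_eq, fun x hx => ?_, fun h0 => hA.dot_ne ?_⟩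
    · have := hA.mulVec_eq
      nth_rewrite 2 [hyz] at this
      rw [Matrix.mulVec_smul] at this
      exact (smul_eq_zero.1 this).resolve_left hs
    · obtain ⟨c, rfl⟩ := hA.ker x hx
      exact ⟨c * s, by rw [hyz, smul_smul]⟩
    · rw [hyz, dotProduct_smul, h0, smul_zero]
  have hAK : (matH B y - 1) * K = proj z v := hK ▸ hAz.mul_inv_mul_proj
  have hP := projSigma_mulVec (w := w) h.fix
    (dotProduct_bil_pos h.B_nonneg h.B_ne_zero hw h.pos).ne'
  have hQ : proj y v = proj z v := by rw [hyz, proj_smul_left z v hs]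
  -- `projSigma` kills `y`, so the pseudoinverse can be traded for `K`.
  rw [jacobian_eq, ← hv, hA.mul_eq_mul hP (hA.mul_pinv_mul_proj.trans (hQ.trans hAK.symm))]
  -- Expressing `σ` through `A` lets `A K = Q` act; the remaining `s⁻¹` is absorbed by `b(·,y) = s
  -- b(·,z)`.
  have hσ : 1 - bilL B (1 - y) - bilR B (1 - y) = s • bilR B z - (matH B y - 1) := by
    rw [matH_eq, bilR_sub, hyz, bilR_smul]
    abel
  have hc : (w ⬝ᵥ bil B y y)⁻¹ • vecMulVec y (sigma B w y) =
      (s⁻¹ * (w ⬝ᵥ bil B z z)⁻¹) • vecMulVec z (sigma B w y) := by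
    nth_rewrite 1 2 3 [hyz]
    rw [bil_smul_left, bil_smul_right, smul_vecMulVec, dotProduct_smul, dotProduct_smul, smul_smul]
    congr 1
    simp only [smul_eq_mul]
    field_simp
  have hKR : K * bilR B y = s • (K * bilR B z) := by rw [hyz, bilR_smul, Matrix.mul_smul]
  have hN : (s • bilR B z - (matH B y - 1)) * (K * bilR B z) =
      s • (bilR B z * (K * bilR B z)) - proj z v * bilR B z := by
    rw [Matrix.sub_mul _ (matH B y - 1), Matrix.smul_mul, ← Matrix.mul_assoc (matH B y - 1), hAK]
  rw [projSigma, hc, Matrix.mul_assoc, hKR, Matrix.mul_smul, Matrix.sub_mul, Matrix.one_mul,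
    Matrix.smul_mul, Matrix.vecMulVec_mul, sigma, Matrix.vecMul_vecMul, hσ, hN, smul_sub, smul_smul,
    mul_inv_cancel_left₀ hs]

theorem tendsto_vecMulVec {ι : Type*} {l : Filter ι} {x y : ι → Fin n → ℝ} {x₀ y₀ : Fin n → ℝ}
    (hx : Tendsto x l (𝓝 x₀)) (hy : Tendsto y l (𝓝 y₀)) :
    Tendsto (fun t => vecMulVec (x t) (y t)) l (𝓝 (vecMulVec x₀ y₀)) := by
  have h : Continuous fun p : (Fin n → ℝ) × (Fin n → ℝ) => vecMulVec p.1 p.2 :=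
    continuous_fst.matrix_vecMulVec continuous_snd
  exact (h.tendsto (x₀, y₀)).comp (hx.prodMk_nhds hy)

theorem tendsto_vecMul (w : Fin n → ℝ) {ι : Type*} {l : Filter ι} {M : ι → Matrix (Fin n) (Fin n) ℝ}
    {M₀ : Matrix (Fin n) (Fin n) ℝ} (hM : Tendsto M l (𝓝 M₀)) :
    Tendsto (fun t => w ᵥ* M t) l (𝓝 (w ᵥ* M₀)) := by
  have h : Continuous fun M : Matrix (Fin n) (Fin n) ℝ => w ᵥ* M :=
    continuous_const.matrix_vecMul continuous_id
  exact (h.tendsto M₀).comp hM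

theorem tendsto_dotProduct {ι : Type*} {l : Filter ι} {x y : ι → Fin n → ℝ} {x₀ y₀ : Fin n → ℝ}
    (hx : Tendsto x l (𝓝 x₀)) (hy : Tendsto y l (𝓝 y₀)) :
    Tendsto (fun t => x t ⬝ᵥ y t) l (𝓝 (x₀ ⬝ᵥ y₀)) := by
  have h : Continuous fun p : (Fin n → ℝ) × (Fin n → ℝ) => p.1 ⬝ᵥ p.2 :=
    continuous_fst.dotProduct continuous_snd
  exact (h.tendsto (x₀, y₀)).comp (hx.prodMk_nhds hy)

section Coefficients

variable {ι : Type*} {l : Filter ι} {B : ι → Matrix (Fin n) (Fin n × Fin n) ℝ} {y : ι → Fin n → ℝ}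
  {B₀ : Matrix (Fin n) (Fin n × Fin n) ℝ} {y₀ : Fin n → ℝ}

theorem tendsto_bilR (hB : Tendsto B l (𝓝 B₀)) (hy : Tendsto y l (𝓝 y₀)) :
    Tendsto (fun t => bilR (B t) (y t)) l (𝓝 (bilR B₀ y₀)) := by
  refine tendsto_pi_nhds.2 fun i => tendsto_pi_nhds.2 fun j => ?_
  simp only [bilR, Matrix.of_apply]
  exact tendsto_finsetSum _ fun k _ =>
    (tendsto_pi_nhds.1 (tendsto_pi_nhds.1 hB i) (j, k)).mul (tendsto_pi_nhds.1 hy k)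

theorem tendsto_bilL (hB : Tendsto B l (𝓝 B₀)) (hy : Tendsto y l (𝓝 y₀)) :
    Tendsto (fun t => bilL (B t) (y t)) l (𝓝 (bilL B₀ y₀)) := by
  refine tendsto_pi_nhds.2 fun i => tendsto_pi_nhds.2 fun k => ?_
  simp only [bilL, Matrix.of_apply]
  exact tendsto_finsetSum _ fun j _ =>
    (tendsto_pi_nhds.1 (tendsto_pi_nhds.1 hB i) (j, k)).mul (tendsto_pi_nhds.1 hy j)

theorem tendsto_matH (hB : Tendsto B l (𝓝 B₀)) (hy : Tendsto y l (𝓝 y₀)) :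
    Tendsto (fun t => matH (B t) (y t)) l (𝓝 (matH B₀ y₀)) :=
  ((tendsto_bilR hB tendsto_const_nhds).add (tendsto_bilL hB tendsto_const_nhds)).sub
    (tendsto_bilL hB hy)

theorem tendsto_bil_self (hB : Tendsto B l (𝓝 B₀)) (hy : Tendsto y l (𝓝 y₀)) :
    Tendsto (fun t => bil (B t) (y t) (y t)) l (𝓝 (bil B₀ y₀ y₀)) := by
  simp only [← bilR_mulVec]
  exact tendsto_mulVec (tendsto_bilR hB hy) hy

end Coefficients

/-- Limit of the Jacobian along survival vectors `y t = s t • z t` with `s t → 0`. -/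
theorem tendsto_jacobian [NeZero n] {ι : Type*} {l : Filter ι}
    {B : ι → Matrix (Fin n) (Fin n × Fin n) ℝ} {y z : ι → Fin n → ℝ} {s : ι → ℝ}
    {B₀ : Matrix (Fin n) (Fin n × Fin n) ℝ} {w z₀ v₀ : Fin n → ℝ} (hw : ∀ i, 0 < w i)
    (hsurv : ∀ᶠ t in l, IsSurvivalVector (B t) (y t)) (hs : ∀ᶠ t in l, s t ≠ 0)
    (hyz : ∀ᶠ t in l, y t = s t • z t) (hB : Tendsto B l (𝓝 B₀)) (hs0 : Tendsto s l (𝓝 0))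
    (hz : Tendsto z l (𝓝 z₀)) (hv : Tendsto (fun t => perronVector (matH (B t) (y t))ᵀ) l (𝓝 v₀))
    (hker : HasSimpleKernel (matR B₀ - 1) z₀ v₀) (hc : w ⬝ᵥ bil B₀ z₀ z₀ ≠ 0) :
    Tendsto (fun t => jacobian (B t) w (y t)) l
      (𝓝 (vecMulVec z₀ ((w ⬝ᵥ bil B₀ z₀ z₀)⁻¹ • w ᵥ* (proj z₀ v₀ * bilR B₀ z₀)))) := by
  set v := fun t => perronVector (matH (B t) (y t))ᵀ
  have hy : Tendsto y l (𝓝 0) := by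
    rw [← zero_smul ℝ z₀]
    exact (hs0.smul hz).congr' (hyz.mono fun t ht => ht.symm)
  have hH : Tendsto (fun t => matH (B t) (y t)) l (𝓝 (matR B₀)) := by
    simpa only [matH_zero] using tendsto_matH hB hy
  have hR : Tendsto (fun t => bilR (B t) (z t)) l (𝓝 (bilR B₀ z₀)) :=
    tendsto_bilR hB hz
  have hzv : Tendsto (fun t => vecMulVec (z t) (v t)) l (𝓝 (vecMulVec z₀ v₀)) :=
    tendsto_vecMulVec hz hv
  have hQ : Tendsto (fun t => proj (z t) (v t)) l (𝓝 (proj z₀ v₀)) := by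
    have hvz : Tendsto (fun t => v t ⬝ᵥ z t) l (𝓝 (v₀ ⬝ᵥ z₀)) :=
      tendsto_dotProduct hv hz
    exact tendsto_const_nhds.sub ((hvz.inv₀ hker.dot_ne).smul hzv)
  -- The rank-one shift keeps the limit matrix invertible although `R - I` is singular.
  have hinv : Tendsto (fun t => (matH (B t) (y t) - 1 - vecMulVec (z t) (v t))⁻¹) l
      (𝓝 (matR B₀ - 1 - vecMulVec z₀ v₀)⁻¹) := by
    have h1 : ContinuousAt Inv.inv (matR B₀ - 1 - vecMulVec z₀ v₀) := by
      refine continuousAt_matrix_inv _ ?_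
      rw [Ring.inverse_eq_inv']
      exact continuousAt_inv₀ hker.isUnit_det_sub.ne_zero
    exact h1.tendsto.comp ((hH.sub tendsto_const_nhds).sub hzv)
  have hc' : Tendsto (fun t => (w ⬝ᵥ bil (B t) (z t) (z t))⁻¹) l (𝓝 (w ⬝ᵥ bil B₀ z₀ z₀)⁻¹) :=
    (tendsto_dotProduct tendsto_const_nhds (tendsto_bil_self hB hz)).inv₀ hc
  have hK := hinv.mul hQ
  have hN := (hs0.smul (hR.mul (hK.mul hR))).sub (hQ.mul hR)
  have hwN := tendsto_vecMul w hN
  have hlim := (hs0.smul (hK.mul hR)).sub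
    (hc'.smul (tendsto_vecMulVec hz hwN))
  have hval : vecMulVec z₀ ((w ⬝ᵥ bil B₀ z₀ z₀)⁻¹ • w ᵥ* (proj z₀ v₀ * bilR B₀ z₀)) =
      (0 : ℝ) • ((matR B₀ - 1 - vecMulVec z₀ v₀)⁻¹ * proj z₀ v₀ * bilR B₀ z₀) -
        (w ⬝ᵥ bil B₀ z₀ z₀)⁻¹ • vecMulVec z₀ (w ᵥ* ((0 : ℝ) • (bilR B₀ z₀ *
          ((matR B₀ - 1 - vecMulVec z₀ v₀)⁻¹ * proj z₀ v₀ * bilR B₀ z₀)) -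
            proj z₀ v₀ * bilR B₀ z₀)) := by
    rw [zero_smul, zero_smul, zero_sub, zero_sub, Matrix.vecMul_neg, vecMulVec_neg, smul_neg,
      neg_neg, vecMulVec_smul]
  rw [hval]
  refine hlim.congr' ?_
  filter_upwards [hsurv, hs, hyz] with t h1 h2 h3
  exact (h1.jacobian_eq_of_eq_smul hw h2 h3 rfl rfl).symm

/-- The rank-one formula gives `|wᵀQ b(y,y) / wᵀb(y,y)|`; the normalizations `r` and `q` cancel. -/
theorem specRad_limit_jacobian [NeZero n] {B : Matrix (Fin n) (Fin n × Fin n) ℝ}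
    {w y v : Fin n → ℝ} {r q : ℝ} (hr : r ≠ 0) (hq : q ≠ 0) (hvy : v ⬝ᵥ y ≠ 0)
    (hc : w ⬝ᵥ bil B y y ≠ 0) :
    specRad (vecMulVec (r • y) ((w ⬝ᵥ bil B (r • y) (r • y))⁻¹ •
      w ᵥ* (proj (r • y) (q • v) * bilR B (r • y)))) =
      |1 - (v ⬝ᵥ bil B y y) / (w ⬝ᵥ bil B y y) * ((w ⬝ᵥ y) / (v ⬝ᵥ y))| := by
  rw [specRad_vecMulVec, dotProduct_smul, dotProduct_comm (r • y), ← Matrix.dotProduct_mulVec,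
    ← Matrix.mulVec_mulVec, bilR_mulVec, proj, Matrix.sub_mulVec, Matrix.one_mulVec,
    Matrix.smul_mulVec, vecMulVec_mulVec_eq_smul]
  simp only [bil_smul_left, bil_smul_right, dotProduct_sub, dotProduct_smul, smul_dotProduct,
    smul_eq_mul]
  congr 1
  field_simp

/-- Any ultrafilter limit in the cube `[0,1]^n` is a nonnegative solution of the critical equation,
hence zero. -/
theorem tendsto_survival {a : ℝ → Fin n → ℝ} {B : ℝ → Matrix (Fin n) (Fin n × Fin n) ℝ}
    {l : Filter ℝ} {B₀ : Matrix (Fin n) (Fin n × Fin n) ℝ} (hB₀ : ∀ i p, 0 ≤ B₀ i p)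
    (hB0 : B₀ ≠ 0) (hirr : (matR B₀).IsIrreducible) {v : Fin n → ℝ} (hv : ∀ i, 0 < v i)
    (hvR : (matR B₀)ᵀ *ᵥ v = v) (hMBT : ∀ᶠ t in l, IsMBT (a t) (B t)) (hB : Tendsto B l (𝓝 B₀)) :
    Tendsto (fun t => survival (a t) (B t)) l (𝓝 0) := by
  rw [tendsto_iff_ultrafilter]
  intro g hg
  have hMBT := hMBT.filter_mono hg
  obtain ⟨y, hy, hlim⟩ := (isCompact_Icc (a := (0 : Fin n → ℝ)) (b := 1)).ultrafilter_le_nhds'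
    (g.map fun t => survival (a t) (B t))
    (Ultrafilter.mem_map.2 (hMBT.mono fun t ht => ⟨survival_nonneg ht, survival_le_one ht⟩))
  have hlim : Tendsto (fun t => survival (a t) (B t)) g (𝓝 y) := hlim
  have hH : Tendsto (fun t => matH (B t) (survival (a t) (B t))) g (𝓝 (matH B₀ y)) :=
    tendsto_matH (hB.mono_left hg) hlim
  have hfix : matH B₀ y *ᵥ y = y := by
    refine tendsto_nhds_unique (tendsto_mulVec hH hlim) (hlim.congr' ?_)
    filter_upwards [hMBT] with t ht using (matH_mulVec_survival ht).symm
  rw [← eq_zero_of_matH_mulVec_eq hB₀ hB0 hirr hv hvR hy.1 hfix]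
  exact hlim

theorem isSurvivalVector_survival {a : Fin n → ℝ} {B : Matrix (Fin n) (Fin n × Fin n) ℝ}
    (h : IsMBT a B) (hs : IsSupercritical B) (hirr : (matR B).IsIrreducible)
    (hlt : ∀ i, survival a B i < 1) : IsSurvivalVector B (survival a B) where
  B_nonneg := h.B_nonneg
  B_ne_zero := ne_zero_of_one_le_specRad (le_of_lt hs)
  irr := hirr
  pos := pos_of_mulVec_eq_smul (matH_isIrreducible h.B_nonneg hirr hlt) (survival_nonneg h)
    (survival_ne_zero h hs) (r := 1) (by rw [matH_mulVec_survival h, one_smul])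
  lt_one := hlt
  fix := matH_mulVec_survival h

end Limit

/-! ### Passage to the critical limit in the family. -/

section Family

variable {n : ℕ} {a : ℝ → Fin n → ℝ} {B : ℝ → Matrix (Fin n) (Fin n × Fin n) ℝ}

theorem tendsto_specRad_jacobian (hMBT : ∀ t ∈ Icc (0 : ℝ) 1, IsMBT (a t) (B t))
    (hcont : ContinuousWithinAt B (Icc 0 1) 1)
    (hsuper : ∀ t ∈ Ico (0 : ℝ) 1, IsSupercritical (B t)) (hcrit : IsCritical (B 1))
    (hirr : ∀ t ∈ Icc (0 : ℝ) 1, (matR (B t)).IsIrreducible) {w : Fin n → ℝ} (hw : ∀ i, 0 < w i)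
    {u v : Fin n → ℝ} (hu : IsPerronVector (matR (B 1)) u) (hv : IsPerronVector (matR (B 1))ᵀ v) :
    Tendsto (fun t => specRad (jacobian (B t) w (survival (a t) (B t)))) (𝓝[<] 1)
      (𝓝 |1 - (v ⬝ᵥ bil (B 1) u u) / (w ⬝ᵥ bil (B 1) u u) * ((w ⬝ᵥ u) / (v ⬝ᵥ u))|) := by
  have h1mem : (1 : ℝ) ∈ Icc (0 : ℝ) 1 := ⟨zero_le_one, le_rfl⟩
  have hcrit : specRad (matR (B 1)) = 1 := hcrit
  have : NeZero n := neZero_of_one_le_specRad hcrit.ge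
  have hB0 : B 1 ≠ 0 := ne_zero_of_one_le_specRad hcrit.ge
  have hBnn := (hMBT 1 h1mem).B_nonneg
  have hirr1 := hirr 1 h1mem
  obtain ⟨hu, hRu⟩ := hu
  obtain ⟨hv, hRv⟩ := hv
  rw [hcrit, one_smul] at hRu
  have hvu := dotProduct_pos hv hu
  -- Evaluating `vᵀRu` in two ways identifies the left eigenvalue with the right one.
  have hcT : specRad (matR (B 1))ᵀ = 1 := by
    have h1 : v ⬝ᵥ (matR (B 1) *ᵥ u) = v ⬝ᵥ u := by rw [hRu]
    rw [Matrix.dotProduct_mulVec, ← Matrix.mulVec_transpose, hRv, smul_dotProduct, smul_eq_mul] at h1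
    exact mul_right_cancel₀ hvu.ne' (h1.trans (one_mul _).symm)
  rw [hcT, one_smul] at hRv
  have hIco : ∀ᶠ t in 𝓝[<] (1 : ℝ), t ∈ Ico (0 : ℝ) 1 := Ico_mem_nhdsLT zero_lt_one
  have hB : Tendsto B (𝓝[<] 1) (𝓝 (B 1)) := hcont.tendsto.mono_left
    (nhdsWithin_le_of_mem (mem_of_superset (Ico_mem_nhdsLT zero_lt_one) Ico_subset_Icc_self))
  set y := fun t => survival (a t) (B t) with hydef
  have hM : ∀ᶠ t in 𝓝[<] (1 : ℝ), IsMBT (a t) (B t) :=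
    hIco.mono fun t ht => hMBT t (Ico_subset_Icc_self ht)
  have hy : Tendsto y (𝓝[<] 1) (𝓝 0) := tendsto_survival hBnn hB0 hirr1 hv hRv hM hB
  -- Near `t = 1` extinction is automatically positive, since survival tends to zero.
  have hlt : ∀ᶠ t in 𝓝[<] (1 : ℝ), ∀ i, y t i < 1 := eventually_all.2 fun i =>
    ((tendsto_pi_nhds.1 hy) i).eventually_lt_const zero_lt_one
  have hsurv : ∀ᶠ t in 𝓝[<] (1 : ℝ), IsSurvivalVector (B t) (y t) := by
    filter_upwards [hIco, hM, hlt] with t h1 h2 h3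
    exact isSurvivalVector_survival h2 (hsuper t h1) (hirr t (Ico_subset_Icc_self h1)) h3
  have hH : Tendsto (fun t => matH (B t) (y t)) (𝓝[<] 1) (𝓝 (matR (B 1))) := by
    simpa only [matH_zero] using tendsto_matH hB hy
  set s := fun t => ∑ i, y t i with hsdef
  have hs : ∀ᶠ t in 𝓝[<] (1 : ℝ), 0 < s t := hsurv.mono fun t ht => sum_pos_of_pos ht.pos
  have hs0 : Tendsto s (𝓝[<] 1) (𝓝 0) := by
    have := tendsto_finsetSum (Finset.univ : Finset (Fin n)) fun i _ => (tendsto_pi_nhds.1 hy) i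
    simpa using this
  have hyz : ∀ᶠ t in 𝓝[<] (1 : ℝ), y t = s t • ((s t)⁻¹ • y t) := hs.mono fun t ht => by
    rw [smul_smul, mul_inv_cancel₀ ht.ne', one_smul]
  have hz : Tendsto (fun t => (s t)⁻¹ • y t) (𝓝[<] 1) (𝓝 ((∑ i, u i)⁻¹ • u)) := by
    refine tendsto_fixed_vector hirr1 hH hu hRu ?_
    filter_upwards [hsurv, hs] with t h1 h2
    refine ⟨⟨fun i => mul_nonneg (inv_nonneg.2 h2.le) (h1.pos i).le, ?_⟩, ?_⟩
    · simp only [Pi.smul_apply, smul_eq_mul, ← Finset.mul_sum]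
      exact inv_mul_cancel₀ h2.ne'
    · rw [Matrix.mulVec_smul, h1.fix]
  have hvt : Tendsto (fun t => perronVector (matH (B t) (y t))ᵀ) (𝓝[<] 1)
      (𝓝 ((∑ i, v i)⁻¹ • v)) := by
    refine tendsto_fixed_vector hirr1.transpose
      ((continuous_id.matrix_transpose.tendsto _).comp hH) hv hRv ?_
    filter_upwards [hsurv] with t ht
    obtain ⟨h1, h2, h3⟩ := perronVector_transpose_spec
      (matH_isIrreducible ht.B_nonneg ht.irr ht.lt_one) ht.pos ht.fix
    exact ⟨⟨fun i => (h1 i).le, h3⟩, h2⟩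
  have hsu := inv_pos.2 (sum_pos_of_pos hu)
  have hsv := inv_pos.2 (sum_pos_of_pos hv)
  have hker : HasSimpleKernel (matR (B 1) - 1) ((∑ i, u i)⁻¹ • u) ((∑ i, v i)⁻¹ • v) :=
    hasSimpleKernel_sub_one hirr1 (fun i => mul_pos hsu (hu i)) (by rw [Matrix.mulVec_smul, hRu])
      (fun i => mul_pos hsv (hv i)) (by rw [Matrix.mulVec_smul, hRv])
  have hJ := tendsto_jacobian hw hsurv (hs.mono fun t ht => ht.ne') hyz hB hs0 hz hvt hker
    (dotProduct_bil_pos hBnn hB0 hw fun i => mul_pos hsu (hu i)).ne'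
  have hlim := (continuous_specRad.tendsto _).comp hJ
  rwa [specRad_limit_jacobian hsu.ne' hsv.ne' hvu.ne' (dotProduct_bil_pos hBnn hB0 hw hu).ne'] at hlim

end Family

end MBT

theorem theorem4 {n : ℕ} (a : ℝ → Fin n → ℝ) (B : ℝ → Matrix (Fin n) (Fin n × Fin n) ℝ)
    (hMBT : ∀ t ∈ Icc (0 : ℝ) 1, MBT.IsMBT (a t) (B t))
    (hanalytic : ∀ i p, AnalyticOn ℝ (fun t => B t i p) (Icc (0 : ℝ) 1))
    (hsuper : ∀ t ∈ Ico (0 : ℝ) 1, MBT.IsSupercritical (B t))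
    (hcrit : MBT.IsCritical (B 1))
    (hirr : ∀ t ∈ Icc (0 : ℝ) 1, (MBT.matR (B t)).IsIrreducible)
    (w : Fin n → ℝ) (hw : ∀ i, 0 < w i)
    (yhat vhat : Fin n → ℝ)
    (hy : MBT.IsPerronVector (MBT.matR (B 1)) yhat)
    (hv : MBT.IsPerronVector (MBT.matR (B 1))ᵀ vhat) :
    (∀ t ∈ Ico (0 : ℝ) 1, (∀ i, 0 < MBT.extinction (a t) (B t) i) →
      HasFDerivAt (MBT.perronMap (B t) w)
        (LinearMap.toContinuousLinearMap
          (Matrix.toLin' (MBT.jacobian (B t) w (MBT.survival (a t) (B t)))))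
        (MBT.survival (a t) (B t))) ∧
    Tendsto (fun t => MBT.specRad (MBT.jacobian (B t) w (MBT.survival (a t) (B t))))
      (𝓝[<] 1)
      (𝓝 |1 - (vhat ⬝ᵥ MBT.bil (B 1) yhat yhat) / (w ⬝ᵥ MBT.bil (B 1) yhat yhat) *
        ((w ⬝ᵥ yhat) / (vhat ⬝ᵥ yhat))|) ∧
    ((∃ c : ℝ, w = c • vhat) →
      Tendsto (fun t => MBT.specRad (MBT.jacobian (B t) w (MBT.survival (a t) (B t))))
        (𝓝[<] 1) (𝓝 0)) := by
  have h1mem : (1 : ℝ) ∈ Icc (0 : ℝ) 1 := ⟨zero_le_one, le_rfl⟩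
  have hcont : ContinuousWithinAt B (Icc 0 1) 1 :=
    continuousWithinAt_pi.2 fun i => continuousWithinAt_pi.2 fun p =>
      (hanalytic i p).continuousOn 1 h1mem
  have hlim := MBT.tendsto_specRad_jacobian hMBT hcont hsuper hcrit hirr hw hy hv
  have hone : 1 ≤ MBT.specRad (MBT.matR (B 1)) := hcrit.ge
  have : NeZero n := MBT.neZero_of_one_le_specRad hone
  refine ⟨fun t ht hx => ?_, hlim, ?_⟩
  · have ht' := Ico_subset_Icc_self ht
    exact (MBT.isSurvivalVector_survival (hMBT t ht') (hsuper t ht) (hirr t ht')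
      fun i => sub_lt_self _ (hx i)).hasFDerivAt_perronMap hw
  -- For `w = c v̂` the two fractions are `1/c` and `c`.
  · rintro ⟨c, rfl⟩
    have hc : c ≠ 0 := by
      rintro rfl
      simpa using hw 0
    have hb := (MBT.dotProduct_bil_pos (hMBT 1 h1mem).B_nonneg (MBT.ne_zero_of_one_le_specRad hone)
      hv.1 hy.1).ne'
    have hvy := (MBT.dotProduct_pos hv.1 hy.1).ne'
    convert hlim using 2
    simp only [smul_dotProduct, smul_eq_mul]
    field_simp
    simp
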